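/- Let $d\ge 1$ be an integer and $1\le p\le\infty$. A block is a set $R=\prod_{i=1}^d[a_i,b_i]\subset\mathbb R^d$ with $a_i<b_i$ for all $i$; $|R|$ denotes its volume and $\operatorname{diam}(R)$ its Euclidean diameter. Let $\mathbb I=[-\tfrac12,\tfrac12]$, let $V=C^0(\mathbb I^d)$ with the uniform norm, and let $I:V\to V$ be a bounded linear operator with $I\circ I=I$. Assume that there is a largest integer $k\ge 0$ such that all polynomials of total degree at most $k$ belong to the image of $I$, and put $m=k+1$. For a block $R$ let $\phi(x)=x_0+Dx$, with $D$ diagonal with positive diagonal entries, be the unique map of this form with $\phi(\mathbb I^d)=R$, and for $f\in C^0(R)$ put $I_Rf=I(f\circ\phi)\circ\phi^{-1}$. A block partition $\mathcal R$ of a block $R_0$ is a finite collection of blocks whose union is $R_0$ and whose pairwise intersections have zero Lebesgue measure; $I_{\mathcal R}f$ is the function on $R_0$, defined almost everywhere, that coincides with $I_Rf$ on the interior of each $R\in\mathcal R$. A sequence $(\mathcal R_N)_{N\ge1}$ of block partitions of $R_0$ is admissible if $\#\mathcal R_N\le N$ for all $N\ge 1$ and $\sup_{N\ge1}\bigl(N^{1/d}\sup_{R\in\mathcal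 R_N}\operatorname{diam}(R)\bigr)<\infty$. For a homogeneous polynomial $\pi$ of degree $m$ put $$K_I(\pi)=\inf_{|R|=1}\|\pi-I_R\pi\|_{L_p(R)},$$ the infimum being taken over all blocks $R$ of volume $1$. Define $\tau\in(0,\infty)$ by $\frac1\tau=\frac md+\frac1p$. **Theorem.** Let $R_0$ be a block and let $f\in C^m(R_0)$. Identify $\frac{d^mf(x)}{m!}$ with the homogeneous polynomial $\sum_{|\alpha|=m}\frac{\partial^mf(x)}{\partial x^\alpha}\frac{X^\alpha}{\alpha!}$. Then there exists a (perhaps non-admissible) sequence $(\mathcal R_N)_{N\ge1}$ of block partitions of $R_0$ with $\#\mathcal R_N\le N$ for all $N\ge 1$ such that $$\limsup_{N\to\infty}N^{\frac md}\|f-I_{\mathcal R_N}f\|_{L_p(R_0)}\le\left\|K_I\left(\frac{d^mf}{m!}\right)\right\|_{L_\tau(R_0)}.$$ Furthermore, for every $\varepsilon>0$ there exists an admissible sequence $(\mathcal R_N^\varepsilon)_{N\ge1}$ of block partitions of $R_0$ such that $$\limsup_{N\to\infty}N^{\frac md}\|f-I_{\mathcal R_N^\varepsilon}f\|_{L_p(R_0)}\le\left\|K_I\left(\frac{d^mf}{m!}\right)\right\|_{L_\tau(R_0)}+\varepsilon.$$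 -/

import Mathlib

open MeasureTheory Filter
open scoped ENNReal

noncomputable section

namespace BlockApprox

/-- The canonical block `𝕀^d = [-1/2, 1/2]^d`. -/
abbrev unitBox (d : ℕ) : Set (Fin d → ℝ) :=
  Set.Icc (fun _ => -(1 / 2 : ℝ)) (fun _ => (1 / 2 : ℝ))

/-- The Banach space `V = C⁰(𝕀^d)` with the uniform norm. -/
abbrev V (d : ℕ) : Type := C(unitBox d, ℝ)

/-- A block `∏ i, [a i, b i]` with `a i < b i` for all `i`. -/
structure Block (d : ℕ) where
  left : Fin d → ℝ
  right : Fin d → ℝ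
  lt : ∀ i, left i < right i

namespace Block

variable {d : ℕ}

/-- The block as a subset of `ℝ^d`. -/
def toSet (R : Block d) : Set (Fin d → ℝ) := Set.Icc R.left R.right

/-- The `d`-dimensional volume `|R|`. -/
def vol (R : Block d) : ℝ := ∏ i, (R.right i - R.left i)

/-- The Euclidean diameter of the block (the length of its diagonal). -/
def diam (R : Block d) : ℝ := Real.sqrt (∑ i, (R.right i - R.left i) ^ 2)

/-- The map `φ(y) = x₀ + D y`, with `D` diagonal and positive, such that `φ(𝕀^d) = R`. -/
def param (R : Block d) (y : Fin d → ℝ) : Fin d → ℝ :=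
  fun i => (R.left i + R.right i) / 2 + (R.right i - R.left i) * y i

/-- The inverse `φ⁻¹` of `param`. -/
def paramInv (R : Block d) (x : Fin d → ℝ) : Fin d → ℝ :=
  fun i => (x i - (R.left i + R.right i) / 2) / (R.right i - R.left i)

/-- The function `f ∘ φ` as an element of `V = C⁰(𝕀^d)`. It is only meant for functions `f` that are
continuous on `R`; the value is `0` if `f ∘ φ` is not continuous on `𝕀^d`. -/
def pullback (R : Block d) (f : (Fin d → ℝ) → ℝ) : V d :=
  ContinuousMap.mkD (fun y : unitBox d => f (R.param y)) 0

open Classical in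
/-- The function `I_R f = I(f ∘ φ) ∘ φ⁻¹` on the block `R`, extended by `0` outside `R`. -/
def interp (I : V d →L[ℝ] V d) (R : Block d) (f : (Fin d → ℝ) → ℝ) (x : Fin d → ℝ) : ℝ :=
  if h : R.paramInv x ∈ unitBox d then I (R.pullback f) ⟨R.paramInv x, h⟩ else 0

end Block

variable {d : ℕ}

/-- A finite collection of blocks is a block partition of `R₀`: the blocks have union `R₀`, and
distinct blocks intersect in a set of zero Lebesgue measure. -/
def IsBlockPartition (R₀ : Block d) (P : Finset (Block d)) : Prop :=
  (⋃ R ∈ P, R.toSet) = R₀.toSet ∧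
    ∀ R ∈ P, ∀ S ∈ P, R ≠ S → volume (R.toSet ∩ S.toSet) = 0

/-- A sequence `(P N)_{N ≥ 1}` of block partitions of `R₀` with at most `N` blocks in `P N`. -/
def IsPartitionSeq (R₀ : Block d) (P : ℕ → Finset (Block d)) : Prop :=
  ∀ N : ℕ, 1 ≤ N → IsBlockPartition R₀ (P N) ∧ (P N).card ≤ N

/-- Admissibility: `#(P N) ≤ N` for all `N ≥ 1`, and
`sup_{N ≥ 1} N^{1/d} sup_{R ∈ P N} diam R < ∞`. -/
def IsAdmissible (R₀ : Block d) (P : ℕ → Finset (Block d)) : Prop :=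
  IsPartitionSeq R₀ P ∧
    ∃ C : ℝ, ∀ N : ℕ, 1 ≤ N → ∀ R ∈ P N, (N : ℝ) ^ (1 / (d : ℝ)) * R.diam ≤ C

/-- The function `I_P f` that coincides with `I_R f` on the interior of each block `R` of the
block partition `P` (and is `0` on the remaining null set). -/
def partInterp (I : V d →L[ℝ] V d) (P : Finset (Block d)) (f : (Fin d → ℝ) → ℝ) :
    (Fin d → ℝ) → ℝ :=
  fun x => ∑ R ∈ P, (interior R.toSet).indicator (R.interp I f) x

/-- The error `‖f - I_P f‖` in `L_p(R₀)`. -/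
def partError (I : V d →L[ℝ] V d) (p : ℝ≥0∞) (R₀ : Block d) (P : Finset (Block d))
    (f : (Fin d → ℝ) → ℝ) : ℝ≥0∞ :=
  eLpNorm (fun x => f x - partInterp I P f x) p (volume.restrict R₀.toSet)

/-- The restriction of a polynomial to `𝕀^d`, as an element of `V`. -/
def polyV (q : MvPolynomial (Fin d) ℝ) : V d where
  toFun y := MvPolynomial.eval (y : Fin d → ℝ) q
  continuous_toFun := (MvPolynomial.continuous_eval q).comp continuous_subtype_val

/-- The set of all `k` such that the polynomials of total degree at most `k` lie in the image
`V_I` of `I`. -/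
def reproducedDegrees (I : V d →L[ℝ] V d) : Set ℕ :=
  {k | ∀ q : MvPolynomial (Fin d) ℝ, q.totalDegree ≤ k → polyV q ∈ Set.range I}

/-- The error function `K_I(π) = inf_{|R| = 1} ‖π - I_R π‖_{L_p(R)}`, the infimum being taken over
all blocks of unit volume. -/
def errorFunction (I : V d →L[ℝ] V d) (p : ℝ≥0∞) (q : MvPolynomial (Fin d) ℝ) : ℝ≥0∞ :=
  ⨅ R : {R : Block d // R.vol = 1},
    eLpNorm (fun x => MvPolynomial.eval x q - R.1.interp I (fun z => MvPolynomial.eval z q) x) p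
      (volume.restrict R.1.toSet)

/-- The polynomial `d^m f(x) / m!` in the variable `X`, that is `d^m f(x)(X, …, X) / m!`, written as
`∑_{j₁, …, j_m} (1 / m!) (∂_{j₁} ⋯ ∂_{j_m} f)(x) X_{j₁} ⋯ X_{j_m}`; grouping equal monomials gives
`∑_{|α| = m} ∂^α f(x) X^α / α!`. The derivatives are those of `f` on the block `R₀`. -/
def derivPoly (R₀ : Block d) (m : ℕ) (f : (Fin d → ℝ) → ℝ) (x : Fin d → ℝ) :
    MvPolynomial (Fin d) ℝ :=
  ∑ j : Fin m → Fin d,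
    MvPolynomial.C (iteratedFDerivWithin ℝ m f R₀.toSet x (fun i => Pi.single (j i) 1) /
      (m.factorial : ℝ)) * ∏ i, MvPolynomial.X (j i)

/-- `d^m f(x) / m!` is homogeneous of degree `m`. -/
theorem derivPoly_isHomogeneous (R₀ : Block d) (m : ℕ) (f : (Fin d → ℝ) → ℝ) (x : Fin d → ℝ) :
    (derivPoly R₀ m f x).IsHomogeneous m := by
  refine MvPolynomial.IsHomogeneous.sum _ _ _ fun j _ => ?_
  have h := (MvPolynomial.isHomogeneous_C (Fin d)
    (iteratedFDerivWithin ℝ m f R₀.toSet x (fun i => Pi.single (j i) 1) /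
      (m.factorial : ℝ))).mul
    (MvPolynomial.IsHomogeneous.prod Finset.univ (fun i => MvPolynomial.X (R := ℝ) (j i))
      (fun _ => 1) fun i _ => MvPolynomial.isHomogeneous_X ℝ (j i))
  simpa using h

/-- The polynomial `d^m f(x) / m!` takes the value `d^m f(x)(y, …, y) / m!` at `y`. -/
theorem eval_derivPoly (R₀ : Block d) (m : ℕ) (f : (Fin d → ℝ) → ℝ) (x y : Fin d → ℝ) :
    MvPolynomial.eval y (derivPoly R₀ m f x) =
      iteratedFDerivWithin ℝ m f R₀.toSet x (fun _ => y) / (m.factorial : ℝ) := by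
  have hy : y = ∑ l, y l • (Pi.single l (1 : ℝ) : Fin d → ℝ) := by
    ext i
    simp [Finset.sum_apply, Pi.single_apply]
  have h : iteratedFDerivWithin ℝ m f R₀.toSet x (fun _ => y) =
      ∑ j : Fin m → Fin d, (∏ i, y (j i)) *
        iteratedFDerivWithin ℝ m f R₀.toSet x (fun i => Pi.single (j i) 1) := by
    conv_lhs => rw [hy]
    rw [ContinuousMultilinearMap.map_sum]
    refine Finset.sum_congr rfl fun j _ => ?_
    rw [ContinuousMultilinearMap.map_smul_univ, smul_eq_mul]
  rw [h, derivPoly, map_sum, Finset.sum_div]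
  refine Finset.sum_congr rfl fun j _ => ?_
  simp only [map_mul, map_prod, MvPolynomial.eval_C, MvPolynomial.eval_X]
  ring

/-- The exponent `τ` defined by `1 / τ = m / d + 1 / p`. -/
def tauExp (d m : ℕ) (p : ℝ≥0∞) : ℝ≥0∞ := ((m : ℝ≥0∞) / (d : ℝ≥0∞) + p⁻¹)⁻¹

/-- The quantity `‖K_I(d^m f / m!)‖` in `L_τ(R₀)`. -/
def optimalConstant (I : V d →L[ℝ] V d) (p : ℝ≥0∞) (R₀ : Block d) (m : ℕ)
    (f : (Fin d → ℝ) → ℝ) : ℝ≥0∞ :=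
  eLpNorm (fun x => errorFunction I p (derivPoly R₀ m f x)) (tauExp d m p)
    (volume.restrict R₀.toSet)

end BlockApprox

end

open BlockApprox

/-!
Everything rests on the operator `T u = u - I u` with values in `L_p` of the reference block
(`errOp`). It is linear, bounded, and annihilates polynomials of degree at most `k = m - 1`. By a
change of variables the error of `f` on a block `R` is `|R|^{1/p} ‖T (f ∘ φ)‖`
(`Block.eLpNorm_sub_interp`), so Taylor's formula shows that on a small block only `d^m f / m!`
matters, up to its oscillation (`norm_errOp_pullback_le`), and that `K_I` only depends on the side
lengths of the blocks (`errorFunction_derivPoly`).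

Since `‖f - I_P f‖_p ≤ (#P)^{1/p} max_R ‖f - I_R f‖_{L_p(R)}` (`partError_le`) and
`m/d + 1/p = 1/τ`, it suffices to find partitions into at most `N` blocks, each with error at most
`N^{-1/τ} c`, for every `c` above the optimal constant; this treats `p < ∞` and `p = ∞` alike. Fix a
fine grid on whose cells `Q` the form `d^m f` is nearly constant, let `w` be a nearly optimal block
shape of unit volume for this form, with error less than `κ`, and split `Q` uniformly into blocks
with side lengths close to `N^{-1/d} σ w`, where `σ^{d/τ} = c / κ` makes the errors of all blocks
agree (`hasGoodPartitions_of_form`). Rounding the numbers of subdivisions does not matter in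
the limit, and `Q` contributes about `N |Q| (κ / c)^τ` blocks. These numbers add up to less than `N`
because the Riemann sums `∑ |Q| κ^τ` are below `∫ K_I(d^m f / m!)^τ + o(1) < c^τ`
(`hasGoodPartitions_of_lintegral_lt`).

The elongation of near minimizers in `K_I` is not bounded, which would spoil the comparison of
nearby forms. The infimum is therefore first restricted to shapes of bounded size
(`truncatedError`); these truncations decrease to `K_I` and their integrals converge. The
sequence that attains the optimal constant itself comes from a diagonal argument
(`exists_limsup_le_of_forall`), which is where admissibility is lost.
-/

open scoped Topology

noncomputable section

namespace BlockApprox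

variable {d : ℕ}

/-! ### Polynomials under affine substitutions -/

/-- Substituting polynomials of degree at most one does not raise the total degree. -/
theorem totalDegree_bind₁_le {σ τ : Type*} {g : σ → MvPolynomial τ ℝ}
    (hg : ∀ i, (g i).totalDegree ≤ 1) (q : MvPolynomial σ ℝ) :
    (MvPolynomial.bind₁ g q).totalDegree ≤ q.totalDegree := by
  conv_lhs => rw [q.as_sum, map_sum]
  refine MvPolynomial.totalDegree_finsetSum_le fun s hs => ?_
  rw [MvPolynomial.bind₁_monomial]
  refine (MvPolynomial.totalDegree_mul _ _).trans ?_
  rw [MvPolynomial.totalDegree_C, zero_add]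
  refine (MvPolynomial.totalDegree_finsetProd _ _).trans ?_
  refine le_trans (Finset.sum_le_sum fun i _ => ?_) (MvPolynomial.le_totalDegree hs)
  calc (g i ^ s i).totalDegree ≤ s i * (g i).totalDegree := MvPolynomial.totalDegree_pow _ _
    _ ≤ s i := by simpa using Nat.mul_le_mul_left (s i) (hg i)

/-- The top degree part of a product of affine factors does not see the constant terms. -/
theorem totalDegree_prod_add_sub_prod_le {σ ι : Type*} (a : ι → ℝ) (b : ι → MvPolynomial σ ℝ)
    (hb : ∀ i, (b i).totalDegree ≤ 1) (s : Finset ι) (k : ℕ) (hs : s.card ≤ k + 1) :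
    (∏ i ∈ s, (MvPolynomial.C (a i) + b i) - ∏ i ∈ s, b i).totalDegree ≤ k := by
  classical
  induction s using Finset.induction_on generalizing k with
  | empty => simp
  | insert i s hi ih =>
    rw [Finset.card_insert_of_notMem hi] at hs
    rw [Finset.prod_insert hi, Finset.prod_insert hi]
    have hrw : (MvPolynomial.C (a i) + b i) * ∏ j ∈ s, (MvPolynomial.C (a j) + b j)
        - b i * ∏ j ∈ s, b j = b i * (∏ j ∈ s, (MvPolynomial.C (a j) + b j) - ∏ j ∈ s, b j)
        + MvPolynomial.C (a i) * ∏ j ∈ s, (MvPolynomial.C (a j) + b j) := by ring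
    rw [hrw]
    have hP : (∏ j ∈ s, (MvPolynomial.C (a j) + b j)).totalDegree ≤ s.card := by
      refine (MvPolynomial.totalDegree_finsetProd _ _).trans ?_
      refine (Finset.sum_le_card_nsmul _ _ 1 fun j _ => ?_).trans (by simp)
      exact (MvPolynomial.totalDegree_add _ _).trans (by simpa using hb j)
    refine (MvPolynomial.totalDegree_add _ _).trans (max_le ?_ ?_)
    · rcases k with _ | k
      · have : s = ∅ := Finset.card_eq_zero.mp (by omega)
        simp [this]
      · refine (MvPolynomial.totalDegree_mul _ _).trans ?_
        have h1 := ih k (by omega)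
        have h2 := hb i
        omega
    · refine (MvPolynomial.totalDegree_mul _ _).trans ?_
      rw [MvPolynomial.totalDegree_C]
      omega

/-- The side lengths of a block. -/
def Block.sides (R : Block d) : Fin d → ℝ := fun i => R.right i - R.left i

/-- The centre of a block. -/
def Block.center (R : Block d) : Fin d → ℝ := fun i => (R.left i + R.right i) / 2

theorem Block.sides_pos (R : Block d) (i : Fin d) : 0 < R.sides i := sub_pos.2 (R.lt i)

theorem Block.param_eq (R : Block d) (y : Fin d → ℝ) : R.param y = R.center + R.sides * y := rfl

/-- The polynomial `q ∘ φ`, where `φ(y) = c + w y` componentwise. -/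
def affineSubst (c w : Fin d → ℝ) (q : MvPolynomial (Fin d) ℝ) : MvPolynomial (Fin d) ℝ :=
  MvPolynomial.bind₁ (fun i => MvPolynomial.C (c i) + MvPolynomial.C (w i) * MvPolynomial.X i) q

theorem totalDegree_C_mul_X_le (a : ℝ) (i : Fin d) :
    (MvPolynomial.C a * MvPolynomial.X i : MvPolynomial (Fin d) ℝ).totalDegree ≤ 1 :=
  (MvPolynomial.totalDegree_mul _ _).trans (by simp)

theorem totalDegree_affineSubst_le (c w : Fin d → ℝ) (q : MvPolynomial (Fin d) ℝ) :
    (affineSubst c w q).totalDegree ≤ q.totalDegree := by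
  refine totalDegree_bind₁_le (fun i => ?_) q
  exact (MvPolynomial.totalDegree_add _ _).trans (by simpa using totalDegree_C_mul_X_le (w i) i)

theorem eval_affineSubst (c w y : Fin d → ℝ) (q : MvPolynomial (Fin d) ℝ) :
    MvPolynomial.eval y (affineSubst c w q) = MvPolynomial.eval (c + w * y) q := by
  rw [affineSubst, MvPolynomial.eval, MvPolynomial.eval₂Hom_bind₁]
  congr 2
  ext i
  simp

/-- Translating a form of degree `k + 1` changes it by a polynomial of degree at most `k`. -/
theorem totalDegree_affineSubst_derivPoly_sub_le (R₀ : Block d) (k : ℕ) (f : (Fin d → ℝ) → ℝ)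
    (x c w : Fin d → ℝ) :
    (affineSubst c w (derivPoly R₀ (k + 1) f x) -
      affineSubst 0 w (derivPoly R₀ (k + 1) f x)).totalDegree ≤ k := by
  simp only [affineSubst, derivPoly, map_sum, map_mul, map_prod, MvPolynomial.bind₁_C_right,
    MvPolynomial.bind₁_X_right, ← Finset.sum_sub_distrib, ← mul_sub]
  refine MvPolynomial.totalDegree_finsetSum_le fun j _ => ?_
  refine (MvPolynomial.totalDegree_mul _ _).trans ?_
  rw [MvPolynomial.totalDegree_C, zero_add]
  simpa using totalDegree_prod_add_sub_prod_le (fun i => c (j i))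
    (fun i => MvPolynomial.C (w (j i)) * MvPolynomial.X (j i))
    (fun i => totalDegree_C_mul_X_le _ _) Finset.univ k (by simp)

/-! ### Taylor's formula along segments -/

/-- The derivatives of `t ↦ f (c + t v)` are the iterated Fréchet derivatives of `f` evaluated on
the diagonal. -/
theorem iteratedDerivWithin_comp_line {E : Type*} [NormedAddCommGroup E] [NormedSpace ℝ E]
    {f : E → ℝ} {s : Set E} {n : ℕ} (hs : UniqueDiffOn ℝ s) (hf : ContDiffOn ℝ n f s)
    {c v : E} (hcv : ∀ t ∈ Set.Icc (0 : ℝ) 1, c + t • v ∈ s) {j : ℕ} (hj : j ≤ n) {t : ℝ}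
    (ht : t ∈ Set.Icc (0 : ℝ) 1) :
    iteratedDerivWithin j (fun t : ℝ => f (c + t • v)) (Set.Icc 0 1) t =
      iteratedFDerivWithin ℝ j f s (c + t • v) (fun _ => v) := by
  induction j generalizing t with
  | zero => simp
  | succ j ih =>
    rw [iteratedDerivWithin_succ]
    have hcongr : Set.EqOn (iteratedDerivWithin j (fun t : ℝ => f (c + t • v)) (Set.Icc 0 1))
        (fun t => iteratedFDerivWithin ℝ j f s (c + t • v) (fun _ => v)) (Set.Icc 0 1) :=
      fun t ht => ih (by omega) ht
    rw [derivWithin_congr hcongr (hcongr ht)]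
    have hdiff : DifferentiableWithinAt ℝ (iteratedFDerivWithin ℝ j f s) s (c + t • v) :=
      hf.differentiableOn_iteratedFDerivWithin (by exact_mod_cast hj) hs _ (hcv t ht)
    have hline : HasDerivWithinAt (fun t : ℝ => c + t • v) v (Set.Icc 0 1) t := by
      simpa using (((hasDerivAt_id t).smul_const v).const_add c).hasDerivWithinAt
    have h1 := hdiff.hasFDerivWithinAt.comp_hasDerivWithinAt t hline hcv
    have h2 := ((ContinuousMultilinearMap.apply ℝ (fun _ : Fin j => E) ℝ
      (fun _ => v)).hasFDerivAt.comp_hasDerivWithinAt t h1)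
    have h3 := h2.derivWithin (uniqueDiffOn_Icc zero_lt_one t ht)
    rw [iteratedFDerivWithin_succ_apply_left]
    exact h3

/-- **Taylor's formula** with the Lagrange form of the remainder, for a function of class
`C^{k+1}` on a set containing the segment from `c` to `c + v`. -/
theorem exists_taylor_segment {E : Type*} [NormedAddCommGroup E] [NormedSpace ℝ E]
    {f : E → ℝ} {s : Set E} {k : ℕ} (hs : UniqueDiffOn ℝ s)
    (hf : ContDiffOn ℝ ((k + 1 : ℕ) : WithTop ℕ∞) f s)
    {c v : E} (hcv : ∀ t ∈ Set.Icc (0 : ℝ) 1, c + t • v ∈ s) :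
    ∃ t ∈ Set.Icc (0 : ℝ) 1, f (c + v) =
      ∑ j ∈ Finset.range (k + 1), iteratedFDerivWithin ℝ j f s c (fun _ => v) / (j.factorial : ℝ) +
        iteratedFDerivWithin ℝ (k + 1) f s (c + t • v) (fun _ => v) /
          ((k + 1).factorial : ℝ) := by
  have hline : ContDiff ℝ ((k + 1 : ℕ) : WithTop ℕ∞) (fun t : ℝ => c + t • v) := by fun_prop
  have hg : ContDiffOn ℝ ((k + 1 : ℕ) : WithTop ℕ∞) (fun t : ℝ => f (c + t • v))
      (Set.Icc 0 1) := hf.comp hline.contDiffOn hcv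
  have huIcc : Set.uIcc (0 : ℝ) 1 = Set.Icc 0 1 := Set.uIcc_of_le zero_le_one
  have hd := (hg.differentiableOn_iteratedDerivWithin (m := k)
    (by exact_mod_cast Nat.lt_succ_self k) (uniqueDiffOn_Icc zero_lt_one))
  obtain ⟨t, ht, h⟩ := taylor_mean_remainder_lagrange (f := fun t : ℝ => f (c + t • v))
    (x₀ := 0) (x := 1) (n := k) zero_ne_one
    (by rw [huIcc]; exact hg.of_le (by exact_mod_cast Nat.le_succ k))
    (by rw [huIcc]; exact hd.mono (by rw [Set.uIoo_of_le zero_le_one]; exact Set.Ioo_subset_Icc_self))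
  rw [Set.uIoo_of_le zero_le_one] at ht
  have htI := Set.Ioo_subset_Icc_self ht
  refine ⟨t, htI, ?_⟩
  rw [huIcc, taylor_within_apply, iteratedDerivWithin_comp_line hs hf hcv le_rfl htI] at h
  simp only [one_smul, sub_zero, one_pow, mul_one] at h
  rw [sub_eq_iff_eq_add'] at h
  rw [h]
  congr 1
  refine Finset.sum_congr rfl fun j hj => ?_
  rw [iteratedDerivWithin_comp_line hs hf hcv (by simp at hj; omega) (by simp)]
  simp [div_eq_inv_mul]

/-! ### The error operator on the reference block -/

/-- Lebesgue measure on the reference block. -/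
abbrev boxMeasure (d : ℕ) : Measure (unitBox d) := Measure.comap Subtype.val volume

theorem map_boxMeasure : Measure.map (Subtype.val : unitBox d → Fin d → ℝ) (boxMeasure d) =
    volume.restrict (unitBox d) := map_comap_subtype_coe measurableSet_Icc _

instance isFiniteMeasure_boxMeasure : IsFiniteMeasure (boxMeasure d) :=
  ⟨by
    have h := congrArg (fun μ => μ Set.univ) (map_boxMeasure (d := d))
    simp only [Measure.restrict_apply_univ] at h
    rw [Measure.map_apply measurable_subtype_coe MeasurableSet.univ, Set.preimage_univ] at h
    rw [h]
    exact isCompact_Icc.measure_lt_top⟩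

/-- The operator `u ↦ u - I u`, with values in `L_p` of the reference block. -/
def errOp (I : V d →L[ℝ] V d) (p : ℝ≥0∞) [Fact (1 ≤ p)] :
    V d →L[ℝ] Lp ℝ p (boxMeasure d) :=
  (ContinuousMap.toLp p (boxMeasure d) ℝ).comp (ContinuousLinearMap.id ℝ (V d) - I)

theorem enorm_errOp (I : V d →L[ℝ] V d) (p : ℝ≥0∞) [Fact (1 ≤ p)] (u : V d) :
    ‖errOp I p u‖ₑ = eLpNorm (fun y => u y - I u y) p (boxMeasure d) := by
  rw [Lp.enorm_def]
  exact eLpNorm_congr_ae (ContinuousMap.coeFn_toLp (boxMeasure d) (u - I u))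

theorem errOp_polyV {I : V d →L[ℝ] V d} {p : ℝ≥0∞} [Fact (1 ≤ p)] (hI : ∀ u : V d, I (I u) = I u)
    {k : ℕ} (hk : k ∈ reproducedDegrees I) {q : MvPolynomial (Fin d) ℝ} (hq : q.totalDegree ≤ k) :
    errOp I p (polyV q) = 0 := by
  obtain ⟨u, hu⟩ := hk q hq
  simp [errOp, ← hu, hI]

/-! ### Change of variables between a block and the reference block -/

theorem Block.vol_eq (R : Block d) : R.vol = ∏ i, R.sides i := rfl

theorem Block.vol_pos (R : Block d) : 0 < R.vol := Finset.prod_pos fun i _ => R.sides_pos i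

theorem Block.continuous_param (R : Block d) : Continuous R.param := by
  unfold Block.param
  fun_prop

theorem Block.paramInv_param (R : Block d) (y : Fin d → ℝ) : R.paramInv (R.param y) = y := by
  ext i
  have := (R.sides_pos i).ne'
  simp only [Block.sides] at this
  simp [Block.paramInv, Block.param]
  field_simp

theorem Block.measurableEmbedding_param (R : Block d) : MeasurableEmbedding R.param :=
  R.continuous_param.measurableEmbedding (Function.LeftInverse.injective R.paramInv_param)

theorem Block.param_mem_iff (R : Block d) (y : Fin d → ℝ) : R.param y ∈ R.toSet ↔ y ∈ unitBox d := by
  simp only [Block.toSet, Set.mem_Icc, Pi.le_def, Block.param, ← forall_and]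
  refine forall_congr' fun i => ?_
  have h := R.lt i
  constructor
  · rintro ⟨h1, h2⟩
    constructor <;> nlinarith
  · rintro ⟨h1, h2⟩
    constructor <;> nlinarith

theorem Block.center_mem (R : Block d) : R.center ∈ R.toSet := by
  have h := (R.param_mem_iff 0).2 ⟨fun i => by norm_num, fun i => by norm_num⟩
  rwa [R.param_eq, mul_zero, add_zero] at h

theorem Block.smul_map_param (R : Block d) :
    ENNReal.ofReal R.vol • Measure.map R.param volume = volume := by
  have hdet : (Matrix.diagonal R.sides).det = R.vol := by rw [Matrix.det_diagonal]; rfl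
  have h := Real.smul_map_diagonal_volume_pi (D := R.sides) (by rw [hdet]; exact R.vol_pos.ne')
  rw [hdet, abs_of_pos R.vol_pos] at h
  have hcomp : R.param = (fun x => R.center + x) ∘ Matrix.toLin' (Matrix.diagonal R.sides) := by
    ext y i
    simp [Block.param_eq, Matrix.mulVec_diagonal]
  have hm : Measurable (Matrix.toLin' (Matrix.diagonal R.sides)) :=
    (LinearMap.continuous_of_finiteDimensional _).measurable
  rw [hcomp, ← Measure.map_map (measurable_const_add _) hm, ← Measure.map_smul, h,
    map_add_left_eq_self]

theorem Block.smul_map_param_restrict (R : Block d) :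
    ENNReal.ofReal R.vol • Measure.map (fun y : unitBox d => R.param y) (boxMeasure d) =
      volume.restrict R.toSet := by
  have hpre : R.param ⁻¹' R.toSet = unitBox d := Set.ext R.param_mem_iff
  have hcomp : (fun y : unitBox d => R.param y) = R.param ∘ Subtype.val := rfl
  conv_rhs => rw [← R.smul_map_param]
  rw [Measure.restrict_smul, R.measurableEmbedding_param.restrict_map, hpre, ← map_boxMeasure, hcomp,
    Measure.map_map R.measurableEmbedding_param.measurable measurable_subtype_coe]

theorem Block.pullback_apply {R : Block d} {f : (Fin d → ℝ) → ℝ} (hf : ContinuousOn f R.toSet)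
    (y : unitBox d) : R.pullback f y = f (R.param y) := by
  have hcont : Continuous fun y : unitBox d => f (R.param y) :=
    hf.comp_continuous (R.continuous_param.comp continuous_subtype_val)
      fun y => (R.param_mem_iff y).2 y.2
  exact ContinuousMap.mkD_apply_of_continuous hcont

theorem Block.eLpNorm_sub_interp (I : V d →L[ℝ] V d) (p : ℝ≥0∞) [Fact (1 ≤ p)] {R : Block d}
    {f : (Fin d → ℝ) → ℝ} (hf : ContinuousOn f R.toSet) :
    eLpNorm (fun x => f x - R.interp I f x) p (volume.restrict R.toSet) =
      ENNReal.ofReal R.vol ^ (1 / p).toReal * ‖errOp I p (R.pullback f)‖ₑ := by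
  have hemb : MeasurableEmbedding fun y : unitBox d => R.param y :=
    R.measurableEmbedding_param.comp (MeasurableEmbedding.subtype_coe measurableSet_Icc)
  rw [← R.smul_map_param_restrict, eLpNorm_smul_measure_of_ne_zero
    (by simpa using R.vol_pos), hemb.eLpNorm_map_measure, enorm_errOp, smul_eq_mul]
  congr 2
  ext y
  simp only [Function.comp, Block.interp, R.paramInv_param, Block.pullback_apply hf]
  rw [dif_pos (by rw [R.paramInv_param]; exact y.2)]

/-! ### The error on small blocks -/

variable {m : ℕ}

/-- The function `y ↦ A(w y, …, w y) / m!` on the reference block, where `w y` is the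
componentwise product: the form `A / m!` seen from a block with side lengths `w`. -/
def scaledForm (A : ContinuousMultilinearMap ℝ (fun _ : Fin m => Fin d → ℝ) ℝ) (w : Fin d → ℝ) :
    V d where
  toFun y := A (fun _ => w * y) / (m.factorial : ℝ)
  continuous_toFun := by fun_prop

theorem continuous_scaledForm : Continuous fun
    z : ContinuousMultilinearMap ℝ (fun _ : Fin m => Fin d → ℝ) ℝ × (Fin d → ℝ) =>
      scaledForm z.1 z.2 := by
  refine ContinuousMap.continuous_of_continuous_uncurry _ ?_
  change Continuous fun z : (ContinuousMultilinearMap ℝ (fun _ : Fin m => Fin d → ℝ) ℝ ×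
    (Fin d → ℝ)) × unitBox d => z.1.1 (fun _ => z.1.2 * (z.2 : Fin d → ℝ)) / (m.factorial : ℝ)
  fun_prop

theorem scaledForm_sub (A B : ContinuousMultilinearMap ℝ (fun _ : Fin m => Fin d → ℝ) ℝ)
    (w : Fin d → ℝ) : scaledForm A w - scaledForm B w = scaledForm (A - B) w := by
  ext y
  simp [scaledForm, sub_div]

theorem scaledForm_smul (A : ContinuousMultilinearMap ℝ (fun _ : Fin m => Fin d → ℝ) ℝ)
    (c : ℝ) (w : Fin d → ℝ) : scaledForm A (c • w) = c ^ m • scaledForm A w := by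
  ext y
  have h := A.map_smul_univ (fun _ => c) (fun _ => w * (y : Fin d → ℝ))
  simp only [Finset.prod_const, Finset.card_univ, Fintype.card_fin] at h
  simp [scaledForm, h, mul_div_assoc]

theorem norm_mul_unitBox_le (w : Fin d → ℝ) (y : unitBox d) : ‖w * (y : Fin d → ℝ)‖ ≤ ‖w‖ := by
  refine (norm_mul_le _ _).trans (mul_le_of_le_one_right (norm_nonneg _) ?_)
  refine (pi_norm_le_iff_of_nonneg zero_le_one).2 fun i => ?_
  have h1 := y.2.1 i
  have h2 := y.2.2 i
  simp only at h1 h2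
  rw [Real.norm_eq_abs, abs_le]
  constructor <;> linarith

theorem abs_form_div_factorial_le (A : ContinuousMultilinearMap ℝ (fun _ : Fin m => Fin d → ℝ) ℝ)
    (w : Fin d → ℝ) (y : unitBox d) :
    |A (fun _ => w * (y : Fin d → ℝ)) / (m.factorial : ℝ)| ≤ ‖A‖ * ‖w‖ ^ m := by
  have h := A.le_opNorm_mul_pow_of_le (m := fun _ => w * (y : Fin d → ℝ))
    ((pi_norm_const_le _).trans (norm_mul_unitBox_le w y))
  rw [abs_div, Nat.abs_cast]
  refine (div_le_self (abs_nonneg _) (by exact_mod_cast m.factorial_pos)).trans ?_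
  simpa using h

theorem norm_scaledForm_le (A : ContinuousMultilinearMap ℝ (fun _ : Fin m => Fin d → ℝ) ℝ)
    (w : Fin d → ℝ) : ‖scaledForm A w‖ ≤ ‖A‖ * ‖w‖ ^ m :=
  (ContinuousMap.norm_le _ (by positivity)).2 fun y => abs_form_div_factorial_le A w y

theorem Block.uniqueDiffOn (R : Block d) : UniqueDiffOn ℝ R.toSet := by
  refine uniqueDiffOn_convex (convex_Icc _ _) ?_
  rw [Block.toSet, ← Set.pi_univ_Icc, interior_pi_set Set.finite_univ]
  simp only [interior_Icc]
  exact Set.univ_pi_nonempty_iff.2 fun i => Set.nonempty_Ioo.2 (R.lt i)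

theorem polyV_affineSubst_derivPoly (R₀ : Block d) (f : (Fin d → ℝ) → ℝ) (x w : Fin d → ℝ) :
    polyV (affineSubst 0 w (derivPoly R₀ m f x)) =
      scaledForm (iteratedFDerivWithin ℝ m f R₀.toSet x) w := by
  ext y
  simp only [polyV, ContinuousMap.coe_mk, scaledForm, eval_affineSubst, eval_derivPoly, zero_add]

/-- The error function of `d^m f(x) / m!` only involves the side lengths of the blocks, because
translations change a form of degree `m` by a reproduced polynomial. -/
theorem errorFunction_derivPoly {I : V d →L[ℝ] V d} {p : ℝ≥0∞} [Fact (1 ≤ p)]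
    (hI : ∀ u : V d, I (I u) = I u) {k : ℕ} (hk : k ∈ reproducedDegrees I) (R₀ : Block d)
    (f : (Fin d → ℝ) → ℝ) (x : Fin d → ℝ) :
    errorFunction I p (derivPoly R₀ (k + 1) f x) = ⨅ R : {R : Block d // R.vol = 1},
      ‖errOp I p (scaledForm (iteratedFDerivWithin ℝ (k + 1) f R₀.toSet x) R.1.sides)‖ₑ := by
  refine iInf_congr fun R => ?_
  set q := derivPoly R₀ (k + 1) f x with hq
  have hcont : Continuous fun z => MvPolynomial.eval z q := MvPolynomial.continuous_eval q
  rw [Block.eLpNorm_sub_interp I p hcont.continuousOn, R.2]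
  simp only [ENNReal.ofReal_one, ENNReal.one_rpow, one_mul]
  have hpull : R.1.pullback (fun z => MvPolynomial.eval z q) =
      scaledForm (iteratedFDerivWithin ℝ (k + 1) f R₀.toSet x) R.1.sides +
        polyV (affineSubst R.1.center R.1.sides q - affineSubst 0 R.1.sides q) := by
    rw [← polyV_affineSubst_derivPoly]
    ext y
    rw [Block.pullback_apply hcont.continuousOn]
    simp [polyV, eval_affineSubst, hq, Block.param_eq]
  rw [hpull, map_add, errOp_polyV hI hk (totalDegree_affineSubst_derivPoly_sub_le _ _ _ _ _ _),
    add_zero]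

/-- On a block where the `m`-th derivative is close to a fixed form, the interpolation error is
close to the one of this form: the Taylor polynomial of degree `m - 1` is reproduced. -/
theorem norm_errOp_pullback_le {I : V d →L[ℝ] V d} {p : ℝ≥0∞} [Fact (1 ≤ p)]
    (hI : ∀ u : V d, I (I u) = I u) {k : ℕ} (hk : k ∈ reproducedDegrees I) {R₀ R : Block d}
    (hR : R.toSet ⊆ R₀.toSet) {f : (Fin d → ℝ) → ℝ}
    (hf : ContDiffOn ℝ ((k + 1 : ℕ) : WithTop ℕ∞) f R₀.toSet)
    (A : ContinuousMultilinearMap ℝ (fun _ : Fin (k + 1) => Fin d → ℝ) ℝ) {δ : ℝ}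
    (hA : ∀ x ∈ R.toSet, ‖iteratedFDerivWithin ℝ (k + 1) f R₀.toSet x - A‖ ≤ δ) :
    ‖errOp I p (R.pullback f)‖ ≤
      ‖errOp I p (scaledForm A R.sides)‖ + ‖errOp I p‖ * (δ * ‖R.sides‖ ^ (k + 1)) := by
  set q : MvPolynomial (Fin d) ℝ :=
    ∑ j ∈ Finset.range (k + 1), affineSubst 0 R.sides (derivPoly R₀ j f R.center) with hq
  have hqdeg : q.totalDegree ≤ k := by
    refine MvPolynomial.totalDegree_finsetSum_le fun j hj => ?_
    refine (totalDegree_affineSubst_le _ _ _).trans ?_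
    exact ((derivPoly_isHomogeneous R₀ j f R.center).totalDegree_le).trans
      (Nat.lt_succ_iff.1 (Finset.mem_range.1 hj))
  have hcont : ContinuousOn f R.toSet := hf.continuousOn.mono hR
  have hδ : 0 ≤ δ := (norm_nonneg _).trans (hA _ R.center_mem)
  have hrem : ‖R.pullback f - polyV q - scaledForm A R.sides‖ ≤ δ * ‖R.sides‖ ^ (k + 1) := by
    refine (ContinuousMap.norm_le _ (by positivity)).2 fun y => ?_
    have hseg : ∀ t ∈ Set.Icc (0 : ℝ) 1, R.center + t • (R.sides * (y : Fin d → ℝ)) ∈ R.toSet := by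
      intro t ht
      have hy := (R.param_mem_iff y).2 y.2
      rw [R.param_eq] at hy
      have := (convex_Icc R.left R.right).add_smul_sub_mem R.center_mem hy ht
      simpa [Block.toSet] using this
    obtain ⟨t, ht, h⟩ := exists_taylor_segment R₀.uniqueDiffOn hf fun t ht => hR (hseg t ht)
    have heval : (R.pullback f - polyV q - scaledForm A R.sides) y =
        (iteratedFDerivWithin ℝ (k + 1) f R₀.toSet
          (R.center + t • (R.sides * (y : Fin d → ℝ))) - A) (fun _ => R.sides * y) /
            ((k + 1).factorial : ℝ) := by
      simp only [ContinuousMap.sub_apply, Block.pullback_apply hcont, R.param_eq, h, polyV, hq,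
        ContinuousMap.coe_mk, map_sum, eval_affineSubst, eval_derivPoly, zero_add, scaledForm,
        sub_apply]
      ring
    rw [heval, Real.norm_eq_abs]
    refine (abs_form_div_factorial_le _ _ _).trans ?_
    gcongr
    exact hA _ (hseg t ht)
  have hdec : R.pullback f = scaledForm A R.sides + polyV q +
      (R.pullback f - polyV q - scaledForm A R.sides) := by abel
  rw [hdec, map_add, map_add, errOp_polyV hI hk hqdeg, add_zero]
  refine (norm_add_le _ _).trans ?_
  gcongr
  exact (ContinuousLinearMap.le_opNorm _ _).trans (by gcongr)

/-! ### Block partitions -/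

theorem Block.measurableSet_toSet (R : Block d) : MeasurableSet R.toSet := measurableSet_Icc

theorem Block.volume_toSet (R : Block d) : volume R.toSet = ENNReal.ofReal R.vol := by
  rw [Block.toSet, Real.volume_Icc_pi, Block.vol_eq,
    ENNReal.ofReal_prod_of_nonneg fun i _ => (R.sides_pos i).le]
  rfl

theorem IsBlockPartition.subset {R₀ R : Block d} {P : Finset (Block d)}
    (h : IsBlockPartition R₀ P) (hR : R ∈ P) : R.toSet ⊆ R₀.toSet := by
  rw [← h.1]
  exact Set.subset_biUnion_of_mem (u := fun R : Block d => R.toSet) hR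

theorem isBlockPartition_singleton (R₀ : Block d) : IsBlockPartition R₀ {R₀} := by
  refine ⟨by simp, fun R hR S hS h => ?_⟩
  rw [Finset.mem_singleton] at hR hS
  exact absurd (hR.trans hS.symm) h

open Classical in
/-- Partitioning each block of a partition gives a partition. -/
theorem IsBlockPartition.biUnion {R₀ : Block d} {P : Finset (Block d)}
    (hP : IsBlockPartition R₀ P) {S : Block d → Finset (Block d)}
    (hS : ∀ Q ∈ P, IsBlockPartition Q (S Q)) : IsBlockPartition R₀ (P.biUnion S) := by
  constructor
  · rw [Finset.set_biUnion_biUnion, ← hP.1]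
    exact Set.iUnion₂_congr fun Q hQ => (hS Q hQ).1
  · intro R hR R' hR' hne
    obtain ⟨Q, hQ, hRQ⟩ := Finset.mem_biUnion.1 hR
    obtain ⟨Q', hQ', hRQ'⟩ := Finset.mem_biUnion.1 hR'
    rcases eq_or_ne Q Q' with rfl | hQQ
    · exact (hS Q hQ).2 R hRQ R' hRQ' hne
    · exact measure_mono_null (Set.inter_subset_inter ((hS Q hQ).subset hRQ)
        ((hS Q' hQ').subset hRQ')) (hP.2 Q hQ Q' hQ' hQQ)

theorem lintegral_eq_sum_of_isBlockPartition {R₀ : Block d} {P : Finset (Block d)}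
    (hP : IsBlockPartition R₀ P) (g : (Fin d → ℝ) → ℝ≥0∞) :
    ∫⁻ x in R₀.toSet, g x = ∑ Q ∈ P, ∫⁻ x in Q.toSet, g x := by
  rw [← hP.1]
  exact lintegral_biUnion_finset₀ (fun R hR S hS hne => hP.2 R hR S hS hne)
    (fun R _ => R.measurableSet_toSet.nullMeasurableSet) g

/-- The cell with index `j` when the sides of `R` are split into `n i` equal parts. -/
def Block.cell (R : Block d) (n : Fin d → ℕ) (hn : ∀ i, 0 < n i) (j : ∀ i, Fin (n i)) :
    Block d where
  left i := R.left i + (j i : ℝ) * (R.sides i / n i)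
  right i := R.left i + ((j i : ℝ) + 1) * (R.sides i / n i)
  lt i := by
    have : 0 < R.sides i / n i := div_pos (R.sides_pos i) (by exact_mod_cast hn i)
    linarith

open Classical in
/-- The partition of `R` obtained by splitting its `i`-th side into `n i` equal parts. -/
def Block.grid (R : Block d) (n : Fin d → ℕ) (hn : ∀ i, 0 < n i) : Finset (Block d) :=
  Finset.univ.image (R.cell n hn)

theorem Block.mem_grid {R Q : Block d} {n : Fin d → ℕ} {hn : ∀ i, 0 < n i} :
    Q ∈ R.grid n hn ↔ ∃ j, R.cell n hn j = Q := by
  simp [Block.grid]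

theorem Block.sides_of_mem_grid {R Q : Block d} {n : Fin d → ℕ} {hn : ∀ i, 0 < n i}
    (hQ : Q ∈ R.grid n hn) : Q.sides = fun i => R.sides i / n i := by
  obtain ⟨j, rfl⟩ := Block.mem_grid.1 hQ
  ext i
  simp only [Block.cell, Block.sides]
  ring

theorem Block.card_grid_le (R : Block d) (n : Fin d → ℕ) (hn : ∀ i, 0 < n i) :
    (R.grid n hn).card ≤ ∏ i, n i := by
  classical
  exact Finset.card_image_le.trans (by simp)

theorem Block.isBlockPartition_grid (R : Block d) (n : Fin d → ℕ) (hn : ∀ i, 0 < n i) :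
    IsBlockPartition R (R.grid n hn) := by
  have hn' : ∀ i, (0 : ℝ) < n i := fun i => by exact_mod_cast hn i
  have hpos : ∀ i, 0 < R.sides i / n i := fun i => div_pos (R.sides_pos i) (hn' i)
  have hfull : ∀ i, R.left i + n i * (R.sides i / n i) = R.right i := fun i => by
    rw [mul_div_cancel₀ _ (hn' i).ne', Block.sides]; ring
  constructor
  · apply Set.Subset.antisymm
    · refine Set.iUnion₂_subset fun Q hQ => ?_
      obtain ⟨j, rfl⟩ := Block.mem_grid.1 hQ
      refine Set.Icc_subset_Icc (fun i => ?_) (fun i => ?_)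
      · exact le_add_of_nonneg_right (mul_nonneg (Nat.cast_nonneg _) (hpos i).le)
      · have hj : ((j i : ℕ) : ℝ) + 1 ≤ n i := by exact_mod_cast (j i).2
        rw [← hfull i]
        exact add_le_add_right (mul_le_mul_of_nonneg_right hj (hpos i).le) _
    · intro x hx
      have hx1 : ∀ i, R.left i ≤ x i := hx.1
      have hx2 : ∀ i, x i ≤ R.right i := hx.2
      -- The right endpoints of `R` belong to the last cells, hence the minimum.
      let t : Fin d → ℝ := fun i => (x i - R.left i) / (R.sides i / n i)
      have ht0 : ∀ i, 0 ≤ t i := fun i => div_nonneg (sub_nonneg.2 (hx1 i)) (hpos i).le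
      have htn : ∀ i, t i ≤ n i := fun i => by
        rw [div_le_iff₀ (hpos i)]
        linarith [hfull i, hx2 i]
      have hxt : ∀ i, x i = R.left i + t i * (R.sides i / n i) := fun i => by
        simp only [t]
        rw [div_mul_cancel₀ _ (hpos i).ne']
        ring
      let j : ∀ i, Fin (n i) := fun i => ⟨min ⌊t i⌋₊ (n i - 1), by have := hn i; omega⟩
      have hj1 : ∀ i, ((j i : ℕ) : ℝ) ≤ t i := fun i =>
        le_trans (by exact_mod_cast min_le_left _ _) (Nat.floor_le (ht0 i))
      have hj2 : ∀ i, t i ≤ (j i : ℕ) + 1 := fun i => by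
        rcases le_total ⌊t i⌋₊ (n i - 1) with h | h
        · simp only [j, min_eq_left h]
          exact (Nat.lt_floor_add_one (t i)).le
        · have h1 : (j i : ℕ) + 1 = n i := by
            simp only [j, min_eq_right h]
            have := hn i
            omega
          exact (htn i).trans (by exact_mod_cast h1.ge)
      refine Set.mem_biUnion (Finset.mem_coe.2 (Block.mem_grid.2 ⟨j, rfl⟩))
        ⟨fun i => ?_, fun i => ?_⟩
      · rw [hxt i]
        exact add_le_add_right (mul_le_mul_of_nonneg_right (hj1 i) (hpos i).le) _
      · rw [hxt i]
        exact add_le_add_right (mul_le_mul_of_nonneg_right (hj2 i) (hpos i).le) _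
  · intro Q hQ Q' hQ' hne
    obtain ⟨j, rfl⟩ := Block.mem_grid.1 hQ
    obtain ⟨j', rfl⟩ := Block.mem_grid.1 hQ'
    obtain ⟨i, hi⟩ : ∃ i, j i ≠ j' i := by
      by_contra! h
      exact hne (by rw [funext h])
    have key : ∀ a b : ℕ, a + 1 ≤ b → R.left i + ((a : ℝ) + 1) * (R.sides i / n i) ≤
        R.left i + (b : ℝ) * (R.sides i / n i) := fun a b hab =>
      add_le_add_right (mul_le_mul_of_nonneg_right (by exact_mod_cast hab) (hpos i).le) _
    rw [Block.toSet, Block.toSet, Set.Icc_inter_Icc, Real.volume_Icc_pi]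
    refine Finset.prod_eq_zero (Finset.mem_univ i) (ENNReal.ofReal_eq_zero.2 (sub_nonpos.2 ?_))
    simp only [Pi.inf_apply, Pi.sup_apply]
    rcases lt_or_gt_of_ne hi with h | h
    · exact (inf_le_left.trans (key _ _ h)).trans le_sup_right
    · exact (inf_le_right.trans (key _ _ h)).trans le_sup_left

/-! ### The error of a partition -/

/-- Almost everywhere on a block `R` of the partition, `I_P f` coincides with `I_R f`. -/
theorem partInterp_ae_eq (I : V d →L[ℝ] V d) {R₀ R : Block d} {P : Finset (Block d)}
    (hP : IsBlockPartition R₀ P) (hR : R ∈ P) (f : (Fin d → ℝ) → ℝ) :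
    partInterp I P f =ᵐ[volume.restrict R.toSet] R.interp I f := by
  have h1 : ∀ᵐ x ∂(volume.restrict R.toSet), x ∈ interior R.toSet := by
    have hfr : ∀ᵐ x ∂(volume : Measure (Fin d → ℝ)), x ∉ frontier R.toSet :=
      measure_eq_zero_iff_ae_notMem.1 ((convex_Icc R.left R.right).addHaar_frontier volume)
    filter_upwards [ae_restrict_of_ae hfr, ae_restrict_mem R.measurableSet_toSet] with x hx hxR
    by_contra h
    exact hx ⟨subset_closure hxR, h⟩
  have h2 : ∀ᵐ x ∂(volume.restrict R.toSet), ∀ S ∈ P, S ≠ R → x ∉ S.toSet := by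
    refine (ae_ball_iff P.countable_toSet).2 fun S hS => ?_
    by_cases hne : S = R
    · simp [hne]
    · have : volume (S.toSet ∩ R.toSet) = 0 := hP.2 S hS R hR hne
      rw [ae_restrict_iff' R.measurableSet_toSet]
      filter_upwards [measure_eq_zero_iff_ae_notMem.1 this] with x hx hxR _ hxS
      exact hx ⟨hxS, hxR⟩
  filter_upwards [h1, h2] with x hx1 hx2
  rw [partInterp, Finset.sum_eq_single R, Set.indicator_of_mem hx1]
  · exact fun S hS hne => Set.indicator_of_notMem (fun h => hx2 S hS hne (interior_subset h)) _
  · exact fun h => absurd hR h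

/-- The error of a partition is at most `(#P)^{1/p}` times the largest error of a block. -/
theorem partError_le (I : V d →L[ℝ] V d) {p : ℝ≥0∞} (hp : 1 ≤ p) {R₀ : Block d}
    {P : Finset (Block d)} (hP : IsBlockPartition R₀ P) (f : (Fin d → ℝ) → ℝ) {B : ℝ≥0∞}
    (hB : ∀ R ∈ P, eLpNorm (fun x => f x - R.interp I f x) p (volume.restrict R.toSet) ≤ B) :
    partError I p R₀ P f ≤ (P.card : ℝ≥0∞) ^ (1 / p).toReal * B := by
  have hp0 : p ≠ 0 := (zero_lt_one.trans_le hp).ne'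
  have hB' : ∀ R ∈ P, eLpNorm (fun x => f x - partInterp I P f x) p
      (volume.restrict R.toSet) ≤ B := fun R hR => by
    refine le_of_eq_of_le (eLpNorm_congr_ae ?_) (hB R hR)
    filter_upwards [partInterp_ae_eq I hP hR f] with x hx
    rw [hx]
  rw [partError]
  set g : (Fin d → ℝ) → ℝ := fun x => f x - partInterp I P f x
  rcases eq_or_ne p ∞ with rfl | hptop
  · simp only [eLpNorm_exponent_top, ENNReal.div_top, ENNReal.toReal_zero, ENNReal.rpow_zero,
      one_mul] at hB' ⊢
    refine essSup_le_of_ae_le B ?_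
    rw [← hP.1, EventuallyLE, Filter.Eventually, ae_restrict_biUnion_finset_eq]
    simp only [Filter.mem_iSup]
    exact fun R hR => (ae_le_essSup (f := fun x => ‖g x‖ₑ)).mono fun x hx => hx.trans (hB' R hR)
  · have hpos : 0 < p.toReal := ENNReal.toReal_pos hp0 hptop
    have hint : ∀ R ∈ P, ∫⁻ x in R.toSet, ‖g x‖ₑ ^ p.toReal ≤ B ^ p.toReal := fun R hR => by
      have h := hB' R hR
      rw [eLpNorm_eq_lintegral_rpow_enorm_toReal hp0 hptop, one_div] at h
      exact (ENNReal.rpow_inv_le_iff hpos).1 h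
    rw [eLpNorm_eq_lintegral_rpow_enorm_toReal hp0 hptop, one_div,
      ENNReal.rpow_inv_le_iff hpos, lintegral_eq_sum_of_isBlockPartition hP,
      ENNReal.mul_rpow_of_nonneg _ _ hpos.le, ← ENNReal.rpow_mul, one_div, ENNReal.toReal_inv,
      inv_mul_cancel₀ hpos.ne', ENNReal.rpow_one]
    exact (Finset.sum_le_card_nsmul _ _ _ hint).trans (by rw [nsmul_eq_mul])

/-! ### Asymptotically good partitions -/

/-- For all large scales `a`, the block `Q` has a partition into at most `ρ a^d` blocks of diameter
`O(1/a)`, on each of which the interpolation error is at most `a^{-m-d/p} c`. The scale `a` stands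
for `N^{1/d}`. -/
def HasGoodPartitions (I : V d →L[ℝ] V d) (p : ℝ≥0∞) (f : (Fin d → ℝ) → ℝ) (m : ℕ) (c : ℝ)
    (Q : Block d) (ρ : ℝ) : Prop :=
  ∃ C : ℝ, ∀ᶠ a : ℝ in atTop, ∃ S : Finset (Block d), IsBlockPartition Q S ∧
    (S.card : ℝ) ≤ ρ * a ^ d ∧ ∀ R ∈ S, a * R.diam ≤ C ∧
      eLpNorm (fun x => f x - R.interp I f x) p (volume.restrict R.toSet) ≤
        ENNReal.ofReal (((a ^ d)⁻¹) ^ (1 / p).toReal * (a⁻¹) ^ m * c)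

theorem HasGoodPartitions.mono {I : V d →L[ℝ] V d} {p : ℝ≥0∞} {f : (Fin d → ℝ) → ℝ} {m : ℕ}
    {c : ℝ} {Q : Block d} {ρ ρ' : ℝ} (h : HasGoodPartitions I p f m c Q ρ) (hρ : ρ ≤ ρ') :
    HasGoodPartitions I p f m c Q ρ' := by
  obtain ⟨C, hC⟩ := h
  refine ⟨C, ?_⟩
  filter_upwards [hC, eventually_ge_atTop 0] with a ⟨S, hS, hcard, hR⟩ ha
  exact ⟨S, hS, hcard.trans (by gcongr), hR⟩

theorem HasGoodPartitions.glue {I : V d →L[ℝ] V d} {p : ℝ≥0∞} {f : (Fin d → ℝ) → ℝ} {m : ℕ}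
    {c : ℝ} {R₀ : Block d} {P : Finset (Block d)} (hP : IsBlockPartition R₀ P) {ρ : Block d → ℝ}
    (h : ∀ Q ∈ P, HasGoodPartitions I p f m c Q (ρ Q)) :
    HasGoodPartitions I p f m c R₀ (∑ Q ∈ P, ρ Q) := by
  classical
  choose! C hC using h
  refine ⟨∑ Q ∈ P, |C Q|, ?_⟩
  filter_upwards [(Finset.eventually_all P).2 hC] with a ha
  choose! S hS hcard hR using ha
  refine ⟨P.biUnion S, hP.biUnion hS, ?_, fun R hRP => ?_⟩
  · rw [Finset.sum_mul]
    refine le_trans ?_ (Finset.sum_le_sum hcard)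
    exact_mod_cast Finset.card_biUnion_le
  · obtain ⟨Q, hQ, hRQ⟩ := Finset.mem_biUnion.1 hRP
    refine ⟨(hR Q hQ R hRQ).1.trans ((le_abs_self _).trans ?_), (hR Q hQ R hRQ).2⟩
    exact Finset.single_le_sum (f := fun Q => |C Q|) (fun Q _ => abs_nonneg _) hQ

/-- If the `m`-th derivative of `f` is within `δ` of the form `A` on `Q`, then splitting `Q`
uniformly into blocks whose side lengths are close to `w / a` gives good partitions: their number is
about `a^d |Q| / ∏ w`, and their errors are about those of `A` on blocks of shape `w`, up to a
term controlled by `δ`. -/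
theorem hasGoodPartitions_of_form {I : V d →L[ℝ] V d} {p : ℝ≥0∞} [Fact (1 ≤ p)]
    (hI : ∀ u : V d, I (I u) = I u) {k : ℕ} (hk : k ∈ reproducedDegrees I) {R₀ Q : Block d}
    (hQ : Q.toSet ⊆ R₀.toSet) {f : (Fin d → ℝ) → ℝ}
    (hf : ContDiffOn ℝ ((k + 1 : ℕ) : WithTop ℕ∞) f R₀.toSet)
    (A : ContinuousMultilinearMap ℝ (fun _ : Fin (k + 1) => Fin d → ℝ) ℝ) {δ : ℝ}
    (hA : ∀ x ∈ Q.toSet, ‖iteratedFDerivWithin ℝ (k + 1) f R₀.toSet x - A‖ ≤ δ)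
    {w : Fin d → ℝ} (hw : ∀ i, 0 < w i) {c : ℝ}
    (hc : (∏ i, w i) ^ (1 / p).toReal *
      (‖errOp I p (scaledForm A w)‖ + ‖errOp I p‖ * (δ * ‖w‖ ^ (k + 1))) < c)
    {ρ : ℝ} (hρ : Q.vol / ∏ i, w i < ρ) : HasGoodPartitions I p f (k + 1) c Q ρ := by
  set q := (1 / p).toReal with hq
  have hq0 : 0 ≤ q := ENNReal.toReal_nonneg
  let n : ℝ → Fin d → ℕ := fun a i => ⌈Q.sides i / w i * a⌉₊
  let u : ℝ → Fin d → ℝ := fun a i => Q.sides i / (n a i / a)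
  have hLw : ∀ i, 0 < Q.sides i / w i := fun i => div_pos (Q.sides_pos i) (hw i)
  have hn : ∀ i, Tendsto (fun a : ℝ => (n a i : ℝ) / a) atTop (𝓝 (Q.sides i / w i)) :=
    fun i => tendsto_nat_ceil_mul_div_atTop (hLw i).le
  have hu : Tendsto u atTop (𝓝 w) := by
    refine tendsto_pi_nhds.2 fun i => ?_
    have h := (tendsto_const_nhds (x := Q.sides i)).div (hn i) (hLw i).ne'
    rwa [div_div_cancel₀ (Q.sides_pos i).ne'] at h
  have hcount : ∀ᶠ a : ℝ in atTop, ∏ i, ((n a i : ℝ) / a) < ρ := by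
    have h := tendsto_finsetProd Finset.univ fun i _ => hn i
    rw [Finset.prod_div_distrib] at h
    exact h.eventually (gt_mem_nhds hρ)
  have herr : ∀ᶠ a : ℝ in atTop, (∏ i, u a i) ^ q *
      (‖errOp I p (scaledForm A (u a))‖ + ‖errOp I p‖ * (δ * ‖u a‖ ^ (k + 1))) < c := by
    have hcont : Continuous fun v : Fin d → ℝ => (∏ i, v i) ^ q *
        (‖errOp I p (scaledForm A v)‖ + ‖errOp I p‖ * (δ * ‖v‖ ^ (k + 1))) := by
      have h1 : Continuous fun v : Fin d → ℝ => scaledForm A v :=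
        continuous_scaledForm.comp (Continuous.prodMk_right A)
      have h2 : Continuous fun v : Fin d → ℝ => (∏ i, v i) ^ q :=
        (Real.continuous_rpow_const hq0).comp (by fun_prop)
      fun_prop
    exact ((hcont.tendsto w).comp hu).eventually (gt_mem_nhds hc)
  have hdiam : ∀ᶠ a : ℝ in atTop, Real.sqrt (∑ i, u a i ^ 2) < Real.sqrt (∑ i, w i ^ 2) + 1 := by
    have hcont : Continuous fun v : Fin d → ℝ => Real.sqrt (∑ i, v i ^ 2) := by fun_prop
    exact ((hcont.tendsto w).comp hu).eventually (gt_mem_nhds (lt_add_one _))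
  refine ⟨Real.sqrt (∑ i, w i ^ 2) + 1, ?_⟩
  filter_upwards [hcount, herr, hdiam, eventually_gt_atTop 0] with a ha1 ha2 ha3 ha
  have hnpos : ∀ i, 0 < n a i := fun i => Nat.ceil_pos.2 (mul_pos (hLw i) ha)
  refine ⟨Q.grid (n a) hnpos, Q.isBlockPartition_grid _ _, ?_, fun R hR => ?_⟩
  · calc ((Q.grid (n a) hnpos).card : ℝ) ≤ ∏ i, (n a i : ℝ) := by
          exact_mod_cast Q.card_grid_le _ _
      _ = (∏ i, ((n a i : ℝ) / a)) * a ^ d := by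
          rw [Finset.prod_div_distrib, Finset.prod_const, Finset.card_univ, Fintype.card_fin,
            div_mul_cancel₀ _ (pow_pos ha d).ne']
      _ ≤ ρ * a ^ d := by gcongr
  have hsides : R.sides = a⁻¹ • u a := by
    rw [Block.sides_of_mem_grid hR]
    ext i
    have : (n a i : ℝ) ≠ 0 := by exact_mod_cast (hnpos i).ne'
    simp only [u, Pi.smul_apply, smul_eq_mul]
    field_simp
  have hRQ : R.toSet ⊆ Q.toSet := (Q.isBlockPartition_grid _ _).subset hR
  constructor
  · have hd : R.diam = a⁻¹ * Real.sqrt (∑ i, u a i ^ 2) := by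
      change Real.sqrt (∑ i, R.sides i ^ 2) = _
      simp only [hsides, Pi.smul_apply, smul_eq_mul, mul_pow, ← Finset.mul_sum]
      rw [Real.sqrt_mul (by positivity), Real.sqrt_sq (by positivity)]
    rw [hd, mul_inv_cancel_left₀ ha.ne']
    exact ha3.le
  · have hupos : 0 ≤ ∏ i, u a i := Finset.prod_nonneg fun i _ =>
      div_nonneg (Q.sides_pos i).le (div_nonneg (Nat.cast_nonneg _) ha.le)
    have hvol : R.vol = (a ^ d)⁻¹ * ∏ i, u a i := by
      simp [Block.vol_eq, hsides, Finset.prod_mul_distrib]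
    have hloc := norm_errOp_pullback_le (p := p) hI hk (hRQ.trans hQ) hf A
      fun x hx => hA x (hRQ hx)
    rw [hsides, scaledForm_smul, map_smul, norm_smul, norm_smul, norm_pow, mul_pow,
      Real.norm_of_nonneg (inv_nonneg.2 ha.le)] at hloc
    rw [Block.eLpNorm_sub_interp I p (hf.continuousOn.mono (hRQ.trans hQ)), ← hq,
      ENNReal.ofReal_rpow_of_nonneg R.vol_pos.le hq0, ← ofReal_norm,
      ← ENNReal.ofReal_mul (Real.rpow_nonneg R.vol_pos.le _)]
    refine ENNReal.ofReal_le_ofReal ?_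
    calc R.vol ^ q * ‖errOp I p (R.pullback f)‖
        ≤ R.vol ^ q * _ := mul_le_mul_of_nonneg_left hloc (Real.rpow_nonneg R.vol_pos.le _)
      _ = ((a ^ d)⁻¹) ^ q * (a⁻¹) ^ (k + 1) * ((∏ i, u a i) ^ q *
            (‖errOp I p (scaledForm A (u a))‖ + ‖errOp I p‖ * (δ * ‖u a‖ ^ (k + 1)))) := by
          rw [hvol, Real.mul_rpow (by positivity) hupos]
          ring
      _ ≤ _ := by gcongr

/-! ### From good partitions to sequences of partitions -/

theorem rpow_one_div_pow {N d : ℕ} (hd : 1 ≤ d) (m : ℕ) :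
    ((N : ℝ) ^ (1 / (d : ℝ))) ^ m = (N : ℝ) ^ ((m : ℝ) / d) := by
  rw [← Real.rpow_natCast, ← Real.rpow_mul (Nat.cast_nonneg _)]
  congr 1
  field_simp

/-- Good partitions of `R₀` into at most `a^d` blocks, taken at `a = N^{1/d}`, form an admissible
sequence; for small `N` the trivial partition is used. -/
theorem HasGoodPartitions.exists_admissible {I : V d →L[ℝ] V d} {p : ℝ≥0∞} (hp : 1 ≤ p)
    (hd : 1 ≤ d) {f : (Fin d → ℝ) → ℝ} {m : ℕ} {c : ℝ} {R₀ : Block d}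
    (h : HasGoodPartitions I p f m c R₀ 1) :
    ∃ P : ℕ → Finset (Block d), IsAdmissible R₀ P ∧
      ∀ᶠ N : ℕ in atTop, (N : ℝ≥0∞) ^ ((m : ℝ) / (d : ℝ)) * partError I p R₀ (P N) f ≤
        ENNReal.ofReal c := by
  classical
  have hd0 : (0 : ℝ) < d := by exact_mod_cast hd
  obtain ⟨C, hC⟩ := h
  have hlim : Tendsto (fun N : ℕ => (N : ℝ) ^ (1 / (d : ℝ))) atTop atTop :=
    (tendsto_rpow_atTop (by positivity)).comp tendsto_natCast_atTop_atTop
  obtain ⟨N₀, hN₀⟩ := eventually_atTop.1 (hlim.eventually hC)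
  choose! S hS hcard hR using hN₀
  have hpow : ∀ N : ℕ, ((N : ℝ) ^ (1 / (d : ℝ))) ^ d = N := fun N => by
    rw [rpow_one_div_pow hd, div_self hd0.ne', Real.rpow_one]
  have hcardN : ∀ N, N₀ ≤ N → (S N).card ≤ N := fun N hN => by
    have := hcard N hN
    rw [one_mul, hpow] at this
    exact_mod_cast this
  refine ⟨fun N => if N₀ ≤ N then S N else {R₀}, ⟨fun N hN => ?_, ?_⟩, ?_⟩
  · by_cases h : N₀ ≤ N
    · simp only [if_pos h]
      exact ⟨hS N h, hcardN N h⟩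
    · simp only [if_neg h]
      exact ⟨isBlockPartition_singleton R₀, by simpa using hN⟩
  · refine ⟨max C ((N₀ : ℝ) ^ (1 / (d : ℝ)) * R₀.diam), fun N hN R hRN => ?_⟩
    by_cases h : N₀ ≤ N
    · simp only [if_pos h] at hRN
      exact (hR N h R hRN).1.trans (le_max_left _ _)
    · simp only [if_neg h, Finset.mem_singleton] at hRN
      subst hRN
      refine le_trans ?_ (le_max_right _ _)
      have h1 : (N : ℝ) ≤ N₀ := by exact_mod_cast (not_le.1 h).le
      have h2 : 0 ≤ R.diam := Real.sqrt_nonneg _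
      gcongr
  · filter_upwards [eventually_ge_atTop N₀, eventually_ge_atTop 1] with N hN hN1
    simp only [if_pos hN]
    have hN0 : (0 : ℝ) < N := by exact_mod_cast hN1
    set q := (1 / p).toReal with hq
    have hq0 : 0 ≤ q := ENNReal.toReal_nonneg
    have hle := partError_le I hp (hS N hN) f fun R hRS => (hR N hN R hRS).2
    rw [hpow, inv_pow, rpow_one_div_pow hd] at hle
    have hcast : (N : ℝ≥0∞) = ENNReal.ofReal N := (ENNReal.ofReal_natCast N).symm
    calc (N : ℝ≥0∞) ^ ((m : ℝ) / d) * partError I p R₀ (S N) f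
        ≤ (N : ℝ≥0∞) ^ ((m : ℝ) / d) * ((N : ℝ≥0∞) ^ q *
            ENNReal.ofReal ((N : ℝ)⁻¹ ^ q * ((N : ℝ) ^ ((m : ℝ) / d))⁻¹ * c)) := by
          gcongr
          refine hle.trans ?_
          gcongr
          exact hcardN N hN
      _ = ENNReal.ofReal c := by
          rw [hcast, ENNReal.ofReal_rpow_of_pos hN0, ENNReal.ofReal_rpow_of_pos hN0,
            ← ENNReal.ofReal_mul (by positivity), ← ENNReal.ofReal_mul (by positivity),
            Real.inv_rpow hN0.le]
          congr 1
          have h1 : (N : ℝ) ^ ((m : ℝ) / d) ≠ 0 := (Real.rpow_pos_of_pos hN0 _).ne'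
          have h2 : (N : ℝ) ^ q ≠ 0 := (Real.rpow_pos_of_pos hN0 _).ne'
          field_simp

/-- A diagonal argument: if every `A + 1/(n+1)` is eventually reached by some sequence of valid
choices, a single sequence has upper limit at most `A`. -/
theorem exists_limsup_le_of_forall {α : Type*} {valid : ℕ → α → Prop} (e : ℕ → α → ℝ≥0∞)
    (A : ℝ≥0∞)
    (h : ∀ n : ℕ, ∃ P : ℕ → α, (∀ N, 1 ≤ N → valid N (P N)) ∧
      ∀ᶠ N in atTop, e N (P N) ≤ A + ((n : ℝ≥0∞) + 1)⁻¹) :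
    ∃ P : ℕ → α, (∀ N, 1 ≤ N → valid N (P N)) ∧ limsup (fun N => e N (P N)) atTop ≤ A := by
  classical
  choose P hP hev using h
  choose N₀ hN₀ using fun n => eventually_atTop.1 (hev n)
  -- At stage `N` the index is the largest `n ≤ N` whose threshold has been passed.
  let idx : ℕ → ℕ := fun N => Nat.findGreatest (fun n => N₀ n ≤ N) N
  refine ⟨fun N => P (idx N) N, fun N hN => hP _ N hN, ?_⟩
  have hbound : ∀ n : ℕ, limsup (fun N => e N (P (idx N) N)) atTop ≤ A + ((n : ℝ≥0∞) + 1)⁻¹ := by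
    intro n
    refine limsup_le_of_le (by isBoundedDefault) ?_
    filter_upwards [eventually_ge_atTop n, eventually_ge_atTop (N₀ n)] with N hn hNn
    have h1 : n ≤ idx N := Nat.le_findGreatest hn hNn
    have h2 : N₀ (idx N) ≤ N := Nat.findGreatest_spec (P := fun n => N₀ n ≤ N) hn hNn
    refine (hN₀ (idx N) N h2).trans ?_
    gcongr
  refine ge_of_tendsto' (x := atTop) ?_ hbound
  have h1 : Tendsto (fun n : ℕ => ((n : ℝ≥0∞) + 1)⁻¹) atTop (𝓝 0) := by
    have := (tendsto_add_atTop_iff_nat 1).2 ENNReal.tendsto_inv_nat_nhds_zero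
    simpa using this
  simpa using (tendsto_const_nhds (x := A)).add h1

/-! ### Truncation of the error function -/

/-- The infimum defining `K_I`, restricted to unit volume blocks with sides of length at most `M + 1`
and increased by `2 / (M + 1)`. Unlike `K_I` itself, it only involves finitely elongated blocks,
for which the error depends uniformly continuously on the form. -/
def truncatedError {m : ℕ} (I : V d →L[ℝ] V d) (p : ℝ≥0∞) [Fact (1 ≤ p)] (M : ℕ)
    (A : ContinuousMultilinearMap ℝ (fun _ : Fin m => Fin d → ℝ) ℝ) : ℝ≥0∞ :=
  (⨅ R : {R : Block d // R.vol = 1 ∧ ‖R.sides‖ ≤ M + 1}, ‖errOp I p (scaledForm A R.1.sides)‖ₑ) +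
    2 * ((M : ℝ≥0∞) + 1)⁻¹

theorem measurable_truncatedError {m : ℕ} (I : V d →L[ℝ] V d) (p : ℝ≥0∞) [Fact (1 ≤ p)] (M : ℕ)
    {D : (Fin d → ℝ) → ContinuousMultilinearMap ℝ (fun _ : Fin m => Fin d → ℝ) ℝ}
    (hD : Continuous D) : Measurable fun x => truncatedError I p M (D x) := by
  refine Measurable.add_const (UpperSemicontinuous.measurable ?_) _
  refine upperSemicontinuous_iInf fun R => Continuous.upperSemicontinuous ?_
  have h1 : Continuous fun x => scaledForm (D x) R.1.sides :=
    continuous_scaledForm.comp (hD.prodMk continuous_const)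
  fun_prop

theorem antitone_truncatedError {m : ℕ} (I : V d →L[ℝ] V d) (p : ℝ≥0∞) [Fact (1 ≤ p)]
    (A : ContinuousMultilinearMap ℝ (fun _ : Fin m => Fin d → ℝ) ℝ) :
    Antitone fun M => truncatedError I p M A := by
  intro M M' h
  refine add_le_add (le_iInf fun R => ?_) (by gcongr)
  have hM : (M : ℝ) ≤ M' := by exact_mod_cast h
  exact iInf_le_of_le ⟨R.1, R.2.1, R.2.2.trans (by gcongr)⟩ le_rfl

theorem iInf_truncatedError {m : ℕ} (I : V d →L[ℝ] V d) (p : ℝ≥0∞) [Fact (1 ≤ p)]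
    (A : ContinuousMultilinearMap ℝ (fun _ : Fin m => Fin d → ℝ) ℝ) :
    ⨅ M, truncatedError I p M A =
      ⨅ R : {R : Block d // R.vol = 1}, ‖errOp I p (scaledForm A R.1.sides)‖ₑ := by
  have hlim : Tendsto (fun n : ℕ => 2 * ((n : ℝ≥0∞) + 1)⁻¹) atTop (𝓝 0) := by
    have h := (tendsto_add_atTop_iff_nat 1).2 ENNReal.tendsto_inv_nat_nhds_zero
    have h2 := ENNReal.Tendsto.const_mul (a := 2) h (Or.inr (by simp))
    simpa using h2
  refine le_antisymm (le_iInf fun R => ?_) (le_iInf fun M => ?_)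
  · obtain ⟨M₀, hM₀⟩ := exists_nat_ge ‖R.1.sides‖
    have hsum := (tendsto_const_nhds (x := ‖errOp I p (scaledForm A R.1.sides)‖ₑ)).add hlim
    rw [add_zero] at hsum
    refine ge_of_tendsto hsum ?_
    filter_upwards [eventually_ge_atTop M₀] with M hM
    refine (iInf_le _ M).trans (add_le_add ?_ le_rfl)
    have hM' : (M₀ : ℝ) ≤ M := by exact_mod_cast hM
    exact iInf_le_of_le ⟨R.1, R.2, by linarith⟩ le_rfl
  · exact le_add_right (le_iInf fun R => iInf_le_of_le ⟨R.1, R.2.1⟩ le_rfl)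

/-- The unit cube, as a block. -/
def unitBlock (d : ℕ) : Block d := ⟨fun _ => 0, fun _ => 1, fun _ => zero_lt_one⟩

theorem vol_unitBlock : (unitBlock d).vol = 1 := by simp [Block.vol, unitBlock]

theorem norm_sides_unitBlock_le : ‖(unitBlock d).sides‖ ≤ 1 :=
  (pi_norm_le_iff_of_nonneg zero_le_one).2 fun i => by simp [Block.sides, unitBlock]

theorem truncatedError_le {m : ℕ} (I : V d →L[ℝ] V d) (p : ℝ≥0∞) [Fact (1 ≤ p)] (M : ℕ)
    (A : ContinuousMultilinearMap ℝ (fun _ : Fin m => Fin d → ℝ) ℝ) :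
    truncatedError I p M A ≤ ENNReal.ofReal (‖errOp I p‖ * ‖A‖) + 2 := by
  refine add_le_add ?_ ?_
  · refine iInf_le_of_le ⟨unitBlock d, vol_unitBlock, norm_sides_unitBlock_le.trans (by simp)⟩ ?_
    rw [← ofReal_norm]
    refine ENNReal.ofReal_le_ofReal ((ContinuousLinearMap.le_opNorm _ _).trans ?_)
    gcongr
    refine (norm_scaledForm_le _ _).trans (mul_le_of_le_one_right (norm_nonneg _) ?_)
    exact pow_le_one₀ (norm_nonneg _) norm_sides_unitBlock_le
  · exact mul_le_of_le_one_right' (ENNReal.inv_le_one.2 (by simp))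

/-- For a form `A` there is a block shape of unit volume which is nearly optimal, in the truncated
sense, for all forms `B` close to `A`. -/
theorem exists_shape {m : ℕ} (I : V d →L[ℝ] V d) (p : ℝ≥0∞) [Fact (1 ≤ p)] (M : ℕ)
    (A : ContinuousMultilinearMap ℝ (fun _ : Fin m => Fin d → ℝ) ℝ) {δ : ℝ} (hδ : 0 ≤ δ)
    (hδM : ‖errOp I p‖ * (δ * ((M : ℝ) + 1) ^ m) ≤ 1 / (2 * ((M : ℝ) + 1))) :
    ∃ (R : Block d) (κ : ℝ), R.vol = 1 ∧ 0 < κ ∧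
      ‖errOp I p (scaledForm A R.sides)‖ + ‖errOp I p‖ * (δ * ‖R.sides‖ ^ m) < κ ∧
      ∀ B, ‖B - A‖ ≤ δ → ENNReal.ofReal κ ≤ truncatedError I p M B := by
  have hM : (0 : ℝ) < M + 1 := by positivity
  set η : ℝ := 1 / (2 * ((M : ℝ) + 1)) with hη
  have hη0 : 0 < η := by positivity
  set ι := {R : Block d // R.vol = 1 ∧ ‖R.sides‖ ≤ M + 1}
  have hne : Nonempty ι :=
    ⟨⟨unitBlock d, vol_unitBlock, norm_sides_unitBlock_le.trans (by simp)⟩⟩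
  set s : ℝ := ⨅ R : ι, ‖errOp I p (scaledForm A R.1.sides)‖
  have hbdd : BddBelow (Set.range fun R : ι => ‖errOp I p (scaledForm A R.1.sides)‖) :=
    ⟨0, by rintro _ ⟨R, rfl⟩; exact norm_nonneg _⟩
  have hs0 : 0 ≤ s := le_ciInf fun R => norm_nonneg _
  have hpert : ∀ (R : ι), ‖errOp I p‖ * (δ * ‖R.1.sides‖ ^ m) ≤ η := fun R => by
    refine le_trans ?_ hδM
    have := R.2.2
    gcongr
  obtain ⟨R, hR⟩ := exists_lt_of_ciInf_lt (show s < s + η by linarith)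
  refine ⟨R.1, s + 2 * η, R.2.1, by positivity, by linarith [hpert R], fun B hB => ?_⟩
  have hle : ∀ R' : ι, ENNReal.ofReal (s - η) ≤ ‖errOp I p (scaledForm B R'.1.sides)‖ₑ := by
    intro R'
    rw [← ofReal_norm]
    refine ENNReal.ofReal_le_ofReal ?_
    have h1 : s ≤ ‖errOp I p (scaledForm A R'.1.sides)‖ := ciInf_le hbdd R'
    have h2 : ‖errOp I p (scaledForm A R'.1.sides)‖ - ‖errOp I p (scaledForm B R'.1.sides)‖ ≤ η := by
      refine (norm_sub_norm_le _ _).trans ?_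
      rw [← map_sub, scaledForm_sub]
      refine (ContinuousLinearMap.le_opNorm _ _).trans (le_trans ?_ (hpert R'))
      gcongr
      refine (norm_scaledForm_le _ _).trans ?_
      rw [norm_sub_rev]
      gcongr
    linarith
  have h4 : ENNReal.ofReal (4 * η) = 2 * ((M : ℝ≥0∞) + 1)⁻¹ := by
    have h : 4 * η = 2 * ((M : ℝ) + 1)⁻¹ := by rw [hη]; field_simp; norm_num
    rw [h, ENNReal.ofReal_mul zero_le_two, ENNReal.ofReal_inv_of_pos hM,
      ENNReal.ofReal_add (Nat.cast_nonneg _) zero_le_one]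
    simp
  calc ENNReal.ofReal (s + 2 * η) ≤ ENNReal.ofReal ((s - η) + 4 * η) :=
        ENNReal.ofReal_le_ofReal (by linarith)
    _ ≤ ENNReal.ofReal (s - η) + ENNReal.ofReal (4 * η) := ENNReal.ofReal_add_le
    _ ≤ _ := by
        rw [h4]
        exact add_le_add (le_iInf hle) le_rfl

/-! ### Adapted partitions -/

theorem Block.dist_lt_of_mem {Q : Block d} {r : ℝ} (hr : 0 < r) (hQ : ∀ i, Q.sides i < r)
    {x y : Fin d → ℝ} (hx : x ∈ Q.toSet) (hy : y ∈ Q.toSet) : dist x y < r := by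
  refine (dist_pi_lt_iff hr).2 fun i => lt_of_le_of_lt ?_ (hQ i)
  exact Real.dist_le_of_mem_Icc ⟨hx.1 i, hx.2 i⟩ ⟨hy.1 i, hy.2 i⟩

theorem Block.exists_partition_sides_lt (R : Block d) {r : ℝ} (hr : 0 < r) :
    ∃ P, IsBlockPartition R P ∧ ∀ Q ∈ P, ∀ i, Q.sides i < r := by
  obtain ⟨n, hn⟩ := exists_nat_gt (‖R.sides‖ / r)
  have hn0 : (0 : ℝ) < n := (div_nonneg (norm_nonneg _) hr.le).trans_lt hn
  refine ⟨R.grid (fun _ => n) fun _ => by exact_mod_cast hn0, R.isBlockPartition_grid _ _,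
    fun Q hQ i => ?_⟩
  rw [Block.sides_of_mem_grid hQ, div_lt_iff₀ hn0]
  rw [div_lt_iff₀ hr, mul_comm] at hn
  exact ((le_abs_self _).trans (norm_le_pi_norm R.sides i)).trans_lt hn

theorem Block.exists_continuous_extension {Y : Type*} [TopologicalSpace Y] (R : Block d)
    {g : (Fin d → ℝ) → Y} (hg : ContinuousOn g R.toSet) :
    ∃ D : (Fin d → ℝ) → Y, Continuous D ∧ Set.EqOn D g R.toSet := by
  have hlr : R.left ≤ R.right := fun i => (R.lt i).le
  refine ⟨fun x => g (R.left ⊔ (x ⊓ R.right)), ?_, fun x hx => ?_⟩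
  · have hcont : Continuous fun x : Fin d → ℝ => R.left ⊔ (x ⊓ R.right) :=
      continuous_pi fun i => continuous_const.max ((continuous_apply i).min continuous_const)
    exact hg.comp_continuous hcont fun x => ⟨le_sup_left, sup_le hlr inf_le_right⟩
  · simp only [inf_eq_left.2 hx.2, sup_eq_right.2 hx.1]

theorem exists_truncation_lintegral_lt {I : V d →L[ℝ] V d} {p : ℝ≥0∞} [Fact (1 ≤ p)] {m : ℕ}
    (R₀ : Block d)
    {D : (Fin d → ℝ) → ContinuousMultilinearMap ℝ (fun _ : Fin m => Fin d → ℝ) ℝ}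
    (hD : Continuous D) {τ : ℝ} (hτ : 0 < τ) {b : ℝ≥0∞}
    (hb : ∫⁻ x in R₀.toSet, (⨅ R : {R : Block d // R.vol = 1},
      ‖errOp I p (scaledForm (D x) R.1.sides)‖ₑ) ^ τ < b) :
    ∃ M : ℕ, ∫⁻ x in R₀.toSet, truncatedError I p M (D x) ^ τ < b := by
  have hcomm : ∀ x, (⨅ R : {R : Block d // R.vol = 1},
      ‖errOp I p (scaledForm (D x) R.1.sides)‖ₑ) ^ τ = ⨅ M, truncatedError I p M (D x) ^ τ := by
    intro x
    rw [← iInf_truncatedError]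
    exact (ENNReal.orderIsoRpow τ hτ).map_iInf _
  simp only [hcomm] at hb
  rw [lintegral_iInf] at hb
  · exact iInf_lt_iff.1 hb
  · exact fun M => (measurable_truncatedError I p M hD).pow_const τ
  · exact fun M M' h x => ENNReal.rpow_le_rpow (antitone_truncatedError I p (D x) h) hτ.le
  · obtain ⟨C, hC⟩ := (isCompact_Icc (a := R₀.left) (b := R₀.right)).exists_bound_of_continuousOn
      hD.continuousOn
    have hle : ∫⁻ x in R₀.toSet, truncatedError I p 0 (D x) ^ τ ≤
        ∫⁻ _ in R₀.toSet, (ENNReal.ofReal (‖errOp I p‖ * C) + 2) ^ τ := by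
      refine setLIntegral_mono' R₀.measurableSet_toSet fun x hx => ?_
      refine ENNReal.rpow_le_rpow ((truncatedError_le I p 0 (D x)).trans ?_) hτ.le
      gcongr
      exact hC x hx
    refine (hle.trans_lt ?_).ne
    rw [setLIntegral_const, Block.volume_toSet]
    exact ENNReal.mul_lt_top (ENNReal.rpow_lt_top_of_nonneg hτ.le (by simp)) (by simp)

/-- The adapted partitions: on the cells of a fixed fine grid, where `d^m f` is nearly constant,
all blocks have the nearly optimal shape for the cell, scaled so that all block errors
agree. The number of blocks is governed by the integral of the `τ`-th power of the error function.
-/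
theorem hasGoodPartitions_of_lintegral_lt {I : V d →L[ℝ] V d} {p : ℝ≥0∞} [Fact (1 ≤ p)]
    (hd : 1 ≤ d) (hI : ∀ u : V d, I (I u) = I u) {k : ℕ} (hk : k ∈ reproducedDegrees I)
    {R₀ : Block d} {f : (Fin d → ℝ) → ℝ}
    (hf : ContDiffOn ℝ ((k + 1 : ℕ) : WithTop ℕ∞) f R₀.toSet) {τ : ℝ}
    (hτ : τ⁻¹ = ((k + 1 : ℕ) : ℝ) / d + (1 / p).toReal) {c : ℝ} (hc : 0 < c)
    (hlt : ∫⁻ x in R₀.toSet, errorFunction I p (derivPoly R₀ (k + 1) f x) ^ τ <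
      ENNReal.ofReal c ^ τ) : HasGoodPartitions I p f (k + 1) c R₀ 1 := by
  have hd0 : (0 : ℝ) < d := by exact_mod_cast hd
  have hq0 : 0 ≤ (1 / p).toReal := ENNReal.toReal_nonneg
  have hτ0 : 0 < τ := inv_pos.1 (hτ ▸ by positivity)
  have hg : ContinuousOn (iteratedFDerivWithin ℝ (k + 1) f R₀.toSet) R₀.toSet :=
    hf.continuousOn_iteratedFDerivWithin le_rfl R₀.uniqueDiffOn
  obtain ⟨D, hD, hDeq⟩ := R₀.exists_continuous_extension hg
  obtain ⟨M, hM⟩ : ∃ M : ℕ, ∫⁻ x in R₀.toSet, truncatedError I p M (D x) ^ τ <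
      ENNReal.ofReal c ^ τ := by
    refine exists_truncation_lintegral_lt R₀ hD hτ0 (lt_of_eq_of_lt ?_ hlt)
    refine setLIntegral_congr_fun R₀.measurableSet_toSet fun x hx => ?_
    simp only [errorFunction_derivPoly hI hk, hDeq hx]
  have hM1 : (0 : ℝ) < M + 1 := by positivity
  obtain ⟨δ, hδ, hδM⟩ : ∃ δ : ℝ, 0 < δ ∧
      ‖errOp I p‖ * (δ * ((M : ℝ) + 1) ^ (k + 1)) ≤ 1 / (2 * ((M : ℝ) + 1)) := by
    refine ⟨1 / (2 * ((M : ℝ) + 1)) / ((‖errOp I p‖ + 1) * ((M : ℝ) + 1) ^ (k + 1)),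
      by positivity, ?_⟩
    have h1 : 0 ≤ ‖errOp I p‖ := norm_nonneg (errOp I p)
    have h2 : ‖errOp I p‖ / (‖errOp I p‖ + 1) ≤ 1 := (div_le_one (by positivity)).2 (by linarith)
    have h3 : 0 ≤ 1 / (2 * ((M : ℝ) + 1)) := by positivity
    calc _ = ‖errOp I p‖ / (‖errOp I p‖ + 1) * (1 / (2 * ((M : ℝ) + 1))) := by field_simp
      _ ≤ _ := mul_le_of_le_one_left h3 h2
  obtain ⟨r, hr, hosc⟩ := Metric.uniformContinuousOn_iff.1
    ((isCompact_Icc (a := R₀.left) (b := R₀.right)).uniformContinuousOn_of_continuous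
      hD.continuousOn) δ hδ
  obtain ⟨P, hP, hPr⟩ := R₀.exists_partition_sides_lt hr
  have hDQ : ∀ Q ∈ P, ∀ x ∈ Q.toSet, ‖D x - D Q.center‖ ≤ δ := fun Q hQ x hx => by
    rw [← dist_eq_norm]
    exact (hosc x (hP.subset hQ hx) _ (hP.subset hQ Q.center_mem)
      (Q.dist_lt_of_mem hr (hPr Q hQ) hx Q.center_mem)).le
  choose R κ hvol hκ0 hκ hκB using fun Q : Block d => exists_shape I p M (D Q.center) hδ.le hδM
  -- The volume of `Q` times `κ_Q^τ` is at most the integral over `Q`.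
  have hsum : ∑ Q ∈ P, Q.vol * (κ Q / c) ^ τ < 1 := by
    have h1 : ENNReal.ofReal (∑ Q ∈ P, Q.vol * κ Q ^ τ) < ENNReal.ofReal (c ^ τ) := by
      rw [← ENNReal.ofReal_rpow_of_pos hc]
      refine lt_of_le_of_lt ?_ hM
      rw [lintegral_eq_sum_of_isBlockPartition hP, ENNReal.ofReal_sum_of_nonneg fun Q _ =>
        mul_nonneg Q.vol_pos.le (Real.rpow_nonneg (hκ0 Q).le _)]
      refine Finset.sum_le_sum fun Q hQ => ?_
      rw [ENNReal.ofReal_mul Q.vol_pos.le, ← ENNReal.ofReal_rpow_of_pos (hκ0 Q),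
        ← Block.volume_toSet, mul_comm, ← setLIntegral_const]
      refine setLIntegral_mono' Q.measurableSet_toSet fun x hx => ?_
      exact ENNReal.rpow_le_rpow (hκB Q _ (hDQ Q hQ x hx)) hτ0.le
    have h2 := (ENNReal.ofReal_lt_ofReal_iff (Real.rpow_pos_of_pos hc _)).1 h1
    have h3 : ∑ Q ∈ P, Q.vol * (κ Q / c) ^ τ = (∑ Q ∈ P, Q.vol * κ Q ^ τ) / c ^ τ := by
      rw [Finset.sum_div]
      refine Finset.sum_congr rfl fun Q _ => ?_
      rw [Real.div_rpow (hκ0 Q).le hc.le, mul_div_assoc]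
    rw [h3, div_lt_one (Real.rpow_pos_of_pos hc _)]
    exact h2
  set S := ∑ Q ∈ P, Q.vol * (κ Q / c) ^ τ
  obtain ⟨θ, hθ, hθS⟩ : ∃ θ : ℝ, 0 < θ ∧ S + P.card * θ ≤ 1 := by
    refine ⟨(1 - S) / (P.card + 1), div_pos (by linarith) (by positivity), ?_⟩
    have h1 : (P.card : ℝ) * ((1 - S) / (P.card + 1)) =
        (P.card / (P.card + 1)) * (1 - S) := by ring
    have h2 : (P.card : ℝ) / (P.card + 1) ≤ 1 := (div_le_one (by positivity)).2 (by linarith)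
    rw [h1]
    nlinarith
  refine (HasGoodPartitions.glue hP (ρ := fun Q => Q.vol * (κ Q / c) ^ τ + θ)
    fun Q hQ => ?_).mono ?_
  swap
  · rw [Finset.sum_add_distrib, Finset.sum_const, nsmul_eq_mul]
    exact hθS
  -- The shape `R Q` is scaled by `σ`, where `σ^{d/τ} = c / κ_Q`.
  have hcκ : 0 < c / κ Q := div_pos hc (hκ0 Q)
  set σ : ℝ := (c / κ Q) ^ (τ / d) with hσ
  have hσ0 : 0 < σ := Real.rpow_pos_of_pos hcκ _
  have hσd : σ ^ d = (c / κ Q) ^ τ := by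
    rw [hσ, ← Real.rpow_natCast, ← Real.rpow_mul hcκ.le, div_mul_cancel₀ _ hd0.ne']
  have hσm : (σ ^ d) ^ (1 / p).toReal * σ ^ (k + 1) = c / κ Q := by
    rw [hσd, hσ, ← Real.rpow_natCast (n := k + 1), ← Real.rpow_mul hcκ.le, ← Real.rpow_mul hcκ.le,
      ← Real.rpow_add hcκ]
    have : τ * (1 / p).toReal + τ / d * ((k + 1 : ℕ) : ℝ) = τ * τ⁻¹ := by rw [hτ]; ring
    rw [this, mul_inv_cancel₀ hτ0.ne', Real.rpow_one]
  have hprod : ∏ i, (σ • (R Q).sides) i = σ ^ d := by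
    have := hvol Q
    rw [Block.vol_eq] at this
    simp [Finset.prod_mul_distrib, this]
  refine hasGoodPartitions_of_form hI hk (hP.subset hQ) hf (D Q.center) (δ := δ) (fun x hx => ?_)
    (w := σ • (R Q).sides) (fun i => mul_pos hσ0 ((R Q).sides_pos i)) ?_ ?_
  · rw [← hDeq (hP.subset hQ hx)]
    exact hDQ Q hQ x hx
  · rw [hprod, scaledForm_smul, map_smul, norm_smul, norm_smul, mul_pow, norm_pow,
      Real.norm_of_nonneg hσ0.le]
    calc _ = ((σ ^ d) ^ (1 / p).toReal * σ ^ (k + 1)) *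
          (‖errOp I p (scaledForm (D Q.center) (R Q).sides)‖ +
            ‖errOp I p‖ * (δ * ‖(R Q).sides‖ ^ (k + 1))) := by ring
      _ < c / κ Q * κ Q := by rw [hσm]; exact mul_lt_mul_of_pos_left (hκ Q) hcκ
      _ = c := div_mul_cancel₀ _ (hκ0 Q).ne'
  · rw [hprod, hσd, div_eq_mul_inv, ← Real.inv_rpow hcκ.le, inv_div]
    linarith

/-! ### The exponent and the main estimate -/

theorem toReal_tauExp_inv {p : ℝ≥0∞} (hp : 1 ≤ p) (hd : 1 ≤ d) (m : ℕ) :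
    (tauExp d m p).toReal⁻¹ = (m : ℝ) / d + (1 / p).toReal := by
  have hd0 : (d : ℝ≥0∞) ≠ 0 := by exact_mod_cast (by omega : d ≠ 0)
  have hp0 : p ≠ 0 := (zero_lt_one.trans_le hp).ne'
  rw [tauExp, ENNReal.toReal_inv, inv_inv, ENNReal.toReal_add
    (ENNReal.div_ne_top (ENNReal.natCast_ne_top m) hd0) (ENNReal.inv_ne_top.2 hp0),
    ENNReal.toReal_div, one_div]
  simp

theorem tauExp_ne_zero {p : ℝ≥0∞} (hp : 1 ≤ p) (hd : 1 ≤ d) (m : ℕ) : tauExp d m p ≠ 0 := by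
  have hd0 : (d : ℝ≥0∞) ≠ 0 := by exact_mod_cast (by omega : d ≠ 0)
  have hp0 : p ≠ 0 := (zero_lt_one.trans_le hp).ne'
  exact ENNReal.inv_ne_zero.2 (ENNReal.add_ne_top.2
    ⟨ENNReal.div_ne_top (ENNReal.natCast_ne_top m) hd0, ENNReal.inv_ne_top.2 hp0⟩)

theorem tauExp_ne_top {p : ℝ≥0∞} (k : ℕ) : tauExp d (k + 1) p ≠ ∞ := by
  refine ENNReal.inv_ne_top.2 (ne_of_gt (lt_of_lt_of_le ?_ le_self_add))
  exact ENNReal.div_pos (by simp) (ENNReal.natCast_ne_top d)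

theorem optimalConstant_eq (I : V d →L[ℝ] V d) {p : ℝ≥0∞} (hp : 1 ≤ p) (hd : 1 ≤ d)
    (R₀ : Block d) (k : ℕ) (f : (Fin d → ℝ) → ℝ) :
    optimalConstant I p R₀ (k + 1) f = (∫⁻ x in R₀.toSet,
      errorFunction I p (derivPoly R₀ (k + 1) f x) ^ (tauExp d (k + 1) p).toReal) ^
        (tauExp d (k + 1) p).toReal⁻¹ := by
  rw [optimalConstant, eLpNorm_eq_lintegral_rpow_enorm_toReal (tauExp_ne_zero hp hd _)
    (tauExp_ne_top k), one_div]
  simp only [enorm_eq_self]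

theorem optimalConstant_ne_top {I : V d →L[ℝ] V d} {p : ℝ≥0∞} [Fact (1 ≤ p)] (hd : 1 ≤ d)
    (hI : ∀ u : V d, I (I u) = I u) {k : ℕ} (hk : k ∈ reproducedDegrees I) {R₀ : Block d}
    {f : (Fin d → ℝ) → ℝ} (hf : ContDiffOn ℝ ((k + 1 : ℕ) : WithTop ℕ∞) f R₀.toSet) :
    optimalConstant I p R₀ (k + 1) f ≠ ∞ := by
  have hp : 1 ≤ p := Fact.out
  set τ := (tauExp d (k + 1) p).toReal
  have hτ0 : 0 ≤ τ := ENNReal.toReal_nonneg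
  obtain ⟨C, hC⟩ := (isCompact_Icc (a := R₀.left) (b := R₀.right)).exists_bound_of_continuousOn
    (hf.continuousOn_iteratedFDerivWithin le_rfl R₀.uniqueDiffOn)
  rw [optimalConstant_eq I hp hd]
  refine ENNReal.rpow_ne_top_of_nonneg (inv_nonneg.2 hτ0) (ne_of_lt ?_)
  have hle : ∫⁻ x in R₀.toSet, errorFunction I p (derivPoly R₀ (k + 1) f x) ^ τ ≤
      ∫⁻ _ in R₀.toSet, (ENNReal.ofReal (‖errOp I p‖ * C) + 2) ^ τ := by
    refine setLIntegral_mono' R₀.measurableSet_toSet fun x hx => ENNReal.rpow_le_rpow ?_ hτ0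
    rw [errorFunction_derivPoly hI hk, ← iInf_truncatedError]
    refine (iInf_le _ 0).trans ((truncatedError_le I p 0 _).trans ?_)
    gcongr
    exact hC x hx
  refine hle.trans_lt ?_
  rw [setLIntegral_const, Block.volume_toSet]
  exact ENNReal.mul_lt_top (ENNReal.rpow_lt_top_of_nonneg hτ0 (by simp)) (by simp)

/-- Every value above the optimal constant is eventually reached by an admissible sequence. -/
theorem exists_admissible_eventually_le {I : V d →L[ℝ] V d} {p : ℝ≥0∞} (hp : 1 ≤ p)
    (hd : 1 ≤ d) (hI : ∀ u : V d, I (I u) = I u) {k : ℕ} (hk : k ∈ reproducedDegrees I)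
    {R₀ : Block d} {f : (Fin d → ℝ) → ℝ}
    (hf : ContDiffOn ℝ ((k + 1 : ℕ) : WithTop ℕ∞) f R₀.toSet) {ε : ℝ} (hε : 0 < ε) :
    ∃ P : ℕ → Finset (Block d), IsAdmissible R₀ P ∧ ∀ᶠ N : ℕ in atTop,
      (N : ℝ≥0∞) ^ (((k + 1 : ℕ) : ℝ) / (d : ℝ)) * partError I p R₀ (P N) f ≤
        optimalConstant I p R₀ (k + 1) f + ENNReal.ofReal ε := by
  have : Fact (1 ≤ p) := ⟨hp⟩
  have hfin : optimalConstant I p R₀ (k + 1) f ≠ ∞ := optimalConstant_ne_top hd hI hk hf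
  set K := optimalConstant I p R₀ (k + 1) f with hK
  have hτ := toReal_tauExp_inv hp hd (k + 1)
  have hτ0 : 0 < (tauExp d (k + 1) p).toReal :=
    ENNReal.toReal_pos (tauExp_ne_zero hp hd _) (tauExp_ne_top k)
  set c : ℝ := K.toReal + ε with hc
  have hc0 : 0 < c := by positivity
  have hcK : ENNReal.ofReal c = K + ENNReal.ofReal ε := by
    rw [hc, ENNReal.ofReal_add ENNReal.toReal_nonneg hε.le, ENNReal.ofReal_toReal hfin]
  have hlt : K < ENNReal.ofReal c := by
    rw [hcK]
    exact ENNReal.lt_add_right hfin (by simpa using hε)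
  rw [hK, optimalConstant_eq I hp hd, ENNReal.rpow_inv_lt_iff hτ0] at hlt
  have h := (hasGoodPartitions_of_lintegral_lt hd hI hk hf hτ hc0 hlt).exists_admissible hp hd
  rwa [hcK] at h

end BlockApprox

end

theorem theorem2 (d : ℕ) (hd : 1 ≤ d) (p : ℝ≥0∞) (hp : 1 ≤ p)
    (I : V d →L[ℝ] V d) (hI : ∀ u : V d, I (I u) = I u)
    (k : ℕ) (hk : IsGreatest (reproducedDegrees I) k)
    (m : ℕ) (hm : m = k + 1)
    (R₀ : Block d) (f : (Fin d → ℝ) → ℝ) (hf : ContDiffOn ℝ (m : WithTop ℕ∞) f R₀.toSet) :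
    (∃ P : ℕ → Finset (Block d), IsPartitionSeq R₀ P ∧
      limsup (fun N : ℕ => (N : ℝ≥0∞) ^ ((m : ℝ) / (d : ℝ)) * partError I p R₀ (P N) f) atTop
        ≤ optimalConstant I p R₀ m f) ∧
    (∀ ε : ℝ, 0 < ε → ∃ P : ℕ → Finset (Block d), IsAdmissible R₀ P ∧
      limsup (fun N : ℕ => (N : ℝ≥0∞) ^ ((m : ℝ) / (d : ℝ)) * partError I p R₀ (P N) f) atTop
        ≤ optimalConstant I p R₀ m f + ENNReal.ofReal ε) := by
  subst hm
  constructor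
  · obtain ⟨P, hP, hlim⟩ := exists_limsup_le_of_forall
      (valid := fun N S => IsBlockPartition R₀ S ∧ S.card ≤ N)
      (fun N S => (N : ℝ≥0∞) ^ (((k + 1 : ℕ) : ℝ) / (d : ℝ)) * partError I p R₀ S f)
      (optimalConstant I p R₀ (k + 1) f) fun n => by
        obtain ⟨P, hP, hev⟩ := exists_admissible_eventually_le hp hd hI hk.1 hf
          (ε := ((n : ℝ) + 1)⁻¹) (by positivity)
        refine ⟨P, hP.1, ?_⟩
        have hcast : ENNReal.ofReal ((n : ℝ) + 1)⁻¹ = ((n : ℝ≥0∞) + 1)⁻¹ := by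
          rw [ENNReal.ofReal_inv_of_pos (by positivity),
            ENNReal.ofReal_add (Nat.cast_nonneg _) zero_le_one]
          simp
        rwa [hcast] at hev
    exact ⟨P, hP, hlim⟩
  · intro ε hε
    obtain ⟨P, hP, hev⟩ := exists_admissible_eventually_le hp hd hI hk.1 hf hε
    exact ⟨P, hP, limsup_le_of_le (by isBoundedDefault) hev⟩
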